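/- Let $q,\omega\in\mathbb C$ with $q\neq0$ and $q^n\neq1$ for all $n\ge1$. Put $\omega_0=\omega/(1-q)$, $[n]_q=(q^n-1)/(q-1)$ and $(D_{q,\omega}f)(x)=\dfrac{f(qx+\omega)-f(x)}{(q-1)x+\omega}$ for polynomials $f\in\mathbb C[x]$. A monic OPS is a sequence $(P_n)_{n\ge0}$ of monic polynomials in $\mathbb C[x]$, $\deg P_n=n$, for which there is a linear functional $\mathbf u$ on $\mathbb C[x]$ with $\langle\mathbf u,P_nP_m\rangle=0$ for $n\ne m$ and $\langle\mathbf u,P_n^2\rangle\neq0$ for all $n$. **Theorem.** Let $(P_n)_{n\ge0}$ be a monic OPS. The following are equivalent. (a) There are $N\in\{0,1,2\}$, a monic polynomial $\pi_N$ of degree $N$ and complex numbers $c_{n,j}$ with $c_{n,n+N}=1$ and $c_{n,n}\ne0$ such that $$\pi_N(x)\,D_{q,\omega}P_{n+1}(x)=[n+1]_q\sum_{j=n}^{n+N}c_{n,j}P_j(x),\qquad n=0,1,2,\dots$$ (b) There are $p\in\{q,q^{-1}\}$, a sequence $(R_n)_{n\ge0}$ in the table of $q$-classical OPS below with base $p$,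 and $r\in\mathbb C\setminus\{0\}$ such that $P_n(x)=r^nR_n\big((x-\omega_0)/r\big)$ for all $n\ge0$. **The table of $q$-classical OPS with base $p$.** Let $\Lambda=\{p^{-n}:n=1,2,\dots\}$. Each sequence is given by $R_0=1$ and $xR_n=R_{n+1}+\beta_nR_n+\gamma_nR_{n-1}$ ($R_{-1}=0$), with the following $\beta_n,\gamma_{n+1}$, $n\ge0$. 1. Al-Salam–Carlitz, $a\neq0$: $\beta_n=(a+1)p^n$, $\gamma_{n+1}=-ap^n(1-p^{n+1})$. 2. Big $q$-Laguerre, $ab\ne0$, $a,b\notin\Lambda$: $\beta_n=1-A_n-C_n$, $\gamma_{n+1}=A_nC_{n+1}$, $A_n=(1-ap^{n+1})(1-bp^{n+1})$, $C_n=-abp^{n+1}(1-p^n)$. 3. Little $q$-Laguerre, $a\ne0$, $a\notin\Lambda$: $\beta_n=A_n+C_n$, $\gamma_{n+1}=A_nC_{n+1}$, $A_n=p^n(1-ap^{n+1})$, $C_n=ap^n(1-p^n)$. 4. $l_n(\cdot;a|p)$, $a\neq0$: $\beta_n=a(p^{n+1}+p^n-1)p^n$, $\gamma_{n+1}=-a^2p^{3n+2}(1-p^{n+1})$.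 5. Big $q$-Jacobi, $ac\ne0$, $a,b,c,abp,abc^{-1}\notin\Lambda$: $\beta_n=1-A_n-C_n$, $\gamma_{n+1}=A_nC_{n+1}$, $$A_n=\frac{(1-ap^{n+1})(1-abp^{n+1})(1-cp^{n+1})}{(1-abp^{2n+1})(1-abp^{2n+2})},\quad C_n=\frac{-acp^{n+1}(1-p^n)(1-abc^{-1}p^n)(1-bp^n)}{(1-abp^{2n})(1-abp^{2n+1})}.$$ 6. Little $q$-Jacobi, $a\ne0$, $a,b,abp\notin\Lambda$: $\beta_n=A_n+C_n$, $\gamma_{n+1}=A_nC_{n+1}$, $$A_n=\frac{p^n(1-ap^{n+1})(1-abp^{n+1})}{(1-abp^{2n+1})(1-abp^{2n+2})},\quad C_n=\frac{ap^n(1-p^n)(1-bp^n)}{(1-abp^{2n})(1-abp^{2n+1})}.$$ 7. $q$-Bessel, $a\ne0$, $-a\notin\Lambda$: $\beta_n=A_n+C_n$, $\gamma_{n+1}=A_nC_{n+1}$, $$A_n=\frac{p^n(1+ap^n)}{(1+ap^{2n})(1+ap^{2n+1})},\quad C_n=\frac{ap^{2n-1}(1-p^n)}{(1+ap^{2n-1})(1+ap^{2n})}.$$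 8. $j_n(\cdot;a,b|p)$, $ab\neq0$, $a\notin\Lambda$: $$\beta_n=\frac{abp^n\big(1+ap^{2n}-(1+p)p^n\big)}{(1-ap^{2n-1})(1-ap^{2n+1})},\quad\gamma_{n+1}=\frac{-a^2b^2p^{3n+2}(1-p^{n+1})(1-ap^n)}{(1-ap^{2n})(1-ap^{2n+1})^2(1-ap^{2n+2})}.$$ For $n=0$ the common factors are cancelled before the parameters are inserted: $C_0=0$ in every row that has a $C_n$; $A_0=\frac{(1-ap)(1-cp)}{1-abp^2}$ in row 5, $A_0=\frac{1-ap}{1-abp^2}$ in row 6, $A_0=\frac1{1+ap}$ in row 7; $\beta_0=-\frac{abp}{1-ap}$ and $\gamma_1=-\frac{a^2b^2p^2(1-p)}{(1-ap)^2(1-ap^2)}$ in row 8. -/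

import Mathlib

open Polynomial

noncomputable section

/-- The Hahn operator `(D_{q,ω} f)(x) = (f(qx+ω) - f(x)) / ((q-1)x+ω)` on polynomials. For `q ≠ 1`
the division is exact, see `hahnD_mul`. -/
def hahnD (q ω : ℂ) (f : ℂ[X]) : ℂ[X] :=
  (f.comp (C q * X + C ω) - f) / (C (q - 1) * X + C ω)

theorem hahnD_mul (q ω : ℂ) (hq : q ≠ 1) (f : ℂ[X]) :
    (C (q - 1) * X + C ω) * hahnD q ω f = f.comp (C q * X + C ω) - f := by
  have hdvd : (C q * X + C ω - X) ∣ f.comp (C q * X + C ω) - f.comp X := by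
    have h := Polynomial.sub_dvd_eval_sub (C q * X + C ω) (X : ℂ[X]) (f.map C)
    simpa [Polynomial.eval_map, Polynomial.comp] using h
  have he : (C q * X + C ω - X : ℂ[X]) = C (q - 1) * X + C ω := by
    simp only [C_sub, C_1]; ring
  rw [he, comp_X] at hdvd
  have h0 : (C (q - 1) * X + C ω : ℂ[X]) ≠ 0 := by
    intro h
    have := congrArg (fun p : ℂ[X] => p.coeff 1) h
    simp [coeff_C] at this
    exact hq (sub_eq_zero.mp this)
  exact EuclideanDomain.mul_div_cancel' h0 hdvd

/-- The `q`-number `[n]_q = (q ^ n - 1) / (q - 1)`, for `q ≠ 1`. -/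
def qNumber (q : ℂ) (n : ℕ) : ℂ := (q ^ n - 1) / (q - 1)

/-- `(P n)` is a monic orthogonal polynomial sequence: `P n` is monic of degree `n` and there is a
(regular) linear functional `u` on `ℂ[X]` with `⟨u, P n * P m⟩ = 0` for `n ≠ m` and
`⟨u, P n ^ 2⟩ ≠ 0`. -/
def IsMonicOPS (P : ℕ → ℂ[X]) : Prop :=
  (∀ n, (P n).Monic ∧ (P n).natDegree = n) ∧
    ∃ u : ℂ[X] →ₗ[ℂ] ℂ, ∀ n m, (n ≠ m → u (P n * P m) = 0) ∧ (n = m → u (P n * P m) ≠ 0)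

/-- The self-coherence structure relation
`π_N D_{q,ω} P_{n+1} = [n+1]_q ∑_{j=n}^{n+N} c_{n,j} P_j` for all `n`, for some `N ≤ 2`, some monic
`π_N` of degree `N` and some `c_{n,j}` with `c_{n,n+N} = 1`, `c_{n,n} ≠ 0`. -/
def SelfCoherent (q ω : ℂ) (P : ℕ → ℂ[X]) : Prop :=
  ∃ N : ℕ, N ≤ 2 ∧ ∃ π : ℂ[X], π.Monic ∧ π.natDegree = N ∧ ∃ c : ℕ → ℕ → ℂ,
    (∀ n, c n (n + N) = 1 ∧ c n n ≠ 0) ∧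
      ∀ n, π * hahnD q ω (P (n + 1)) =
        C (qNumber q (n + 1)) * ∑ j ∈ Finset.Icc n (n + N), C (c n j) * P j

/-- The monic polynomials with `P_0 = 1` and `x P_n = P_{n+1} + β_n P_n + γ_n P_{n-1}`.
The second argument lists `γ` from `γ_1` on: its value at `n` is `γ_{n+1}`. -/
def ttrrSeq (β γ : ℕ → ℂ) : ℕ → ℂ[X]
  | 0 => 1
  | 1 => X - C (β 0)
  | n + 2 => (X - C (β (n + 1))) * ttrrSeq β γ (n + 1) - C (γ n) * ttrrSeq β γ n

/-- The set `Λ = {q ^ (-n) : n = 1, 2, …}`. -/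
def LambdaSet (q : ℂ) : Set ℂ := {z | ∃ n : ℕ, 1 ≤ n ∧ z = (q ^ n)⁻¹}

/-- Monic Al-Salam–Carlitz polynomials `U_n^{(a)}(x|q)`. -/
def alSalamCarlitz (q a : ℂ) : ℕ → ℂ[X] :=
  ttrrSeq (fun n => (a + 1) * q ^ n) (fun n => -a * q ^ n * (1 - q ^ (n + 1)))

/-- Coefficient `A_n` of the big `q`-Laguerre polynomials. -/
def bigQLaguerreA (q a b : ℂ) (n : ℕ) : ℂ := (1 - a * q ^ (n + 1)) * (1 - b * q ^ (n + 1))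

/-- Coefficient `C_n` of the big `q`-Laguerre polynomials. -/
def bigQLaguerreC (q a b : ℂ) (n : ℕ) : ℂ := -a * b * q ^ (n + 1) * (1 - q ^ n)

/-- Monic big `q`-Laguerre polynomials `L_n(x;a,b|q)`. -/
def bigQLaguerre (q a b : ℂ) : ℕ → ℂ[X] :=
  ttrrSeq (fun n => 1 - (bigQLaguerreA q a b n + bigQLaguerreC q a b n))
    (fun n => bigQLaguerreA q a b n * bigQLaguerreC q a b (n + 1))

/-- Coefficient `A_n` of the little `q`-Laguerre polynomials. -/
def littleQLaguerreA (q a : ℂ) (n : ℕ) : ℂ := q ^ n * (1 - a * q ^ (n + 1))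

/-- Coefficient `C_n` of the little `q`-Laguerre polynomials. -/
def littleQLaguerreC (q a : ℂ) (n : ℕ) : ℂ := a * q ^ n * (1 - q ^ n)

/-- Monic little `q`-Laguerre polynomials `L_n(x;a|q)`. -/
def littleQLaguerre (q a : ℂ) : ℕ → ℂ[X] :=
  ttrrSeq (fun n => littleQLaguerreA q a n + littleQLaguerreC q a n)
    (fun n => littleQLaguerreA q a n * littleQLaguerreC q a (n + 1))

/-- The monic polynomials `l_n(x;a|q)` of Medem and Álvarez-Nodarse. -/
def smallL (q a : ℂ) : ℕ → ℂ[X] :=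
  ttrrSeq (fun n => a * (q ^ (n + 1) + q ^ n - 1) * q ^ n)
    (fun n => -a ^ 2 * q ^ (3 * n + 2) * (1 - q ^ (n + 1)))

/-- The factor `(1 - d q^{n+1}) / (1 - d q^{2n+1})`, which is identically `1` in `d` for `n = 0`. -/
def jacobiFactor (q d : ℂ) (n : ℕ) : ℂ :=
  if n = 0 then 1 else (1 - d * q ^ (n + 1)) / (1 - d * q ^ (2 * n + 1))

/-- Coefficient `A_n` of the big `q`-Jacobi polynomials. -/
def bigQJacobiA (q a b c : ℂ) (n : ℕ) : ℂ :=
  jacobiFactor q (a * b) n * ((1 - a * q ^ (n + 1)) * (1 - c * q ^ (n + 1)))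
    / (1 - a * b * q ^ (2 * n + 2))

/-- Coefficient `C_n` of the big `q`-Jacobi polynomials, with `C_0 = 0`. -/
def bigQJacobiC (q a b c : ℂ) (n : ℕ) : ℂ :=
  if n = 0 then 0 else
    -a * c * q ^ (n + 1) * (1 - q ^ n) * (1 - a * b * c⁻¹ * q ^ n) * (1 - b * q ^ n)
      / ((1 - a * b * q ^ (2 * n)) * (1 - a * b * q ^ (2 * n + 1)))

/-- Monic big `q`-Jacobi polynomials `P_n(x;a,b,c|q)`. -/
def bigQJacobi (q a b c : ℂ) : ℕ → ℂ[X] :=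
  ttrrSeq (fun n => 1 - (bigQJacobiA q a b c n + bigQJacobiC q a b c n))
    (fun n => bigQJacobiA q a b c n * bigQJacobiC q a b c (n + 1))

/-- Coefficient `A_n` of the little `q`-Jacobi polynomials. -/
def littleQJacobiA (q a b : ℂ) (n : ℕ) : ℂ :=
  q ^ n * jacobiFactor q (a * b) n * (1 - a * q ^ (n + 1)) / (1 - a * b * q ^ (2 * n + 2))

/-- Coefficient `C_n` of the little `q`-Jacobi polynomials, with `C_0 = 0`. -/
def littleQJacobiC (q a b : ℂ) (n : ℕ) : ℂ :=
  if n = 0 then 0 else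
    a * q ^ n * (1 - q ^ n) * (1 - b * q ^ n)
      / ((1 - a * b * q ^ (2 * n)) * (1 - a * b * q ^ (2 * n + 1)))

/-- Monic little `q`-Jacobi polynomials `P_n(x;a,b|q)`. -/
def littleQJacobi (q a b : ℂ) : ℕ → ℂ[X] :=
  ttrrSeq (fun n => littleQJacobiA q a b n + littleQJacobiC q a b n)
    (fun n => littleQJacobiA q a b n * littleQJacobiC q a b (n + 1))

/-- Coefficient `A_n = q^n (1 + a q^n) / ((1 + a q^{2n}) (1 + a q^{2n+1}))` of the `q`-Bessel
polynomials, with `A_0 = 1 / (1 + a q)`. -/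
def qBesselA (q a : ℂ) (n : ℕ) : ℂ :=
  if n = 0 then 1 / (1 + a * q) else
    q ^ n * (1 + a * q ^ n) / ((1 + a * q ^ (2 * n)) * (1 + a * q ^ (2 * n + 1)))

/-- Coefficient `C_n` of the `q`-Bessel polynomials, with `C_0 = 0`. -/
def qBesselC (q a : ℂ) (n : ℕ) : ℂ :=
  if n = 0 then 0 else
    a * q ^ (2 * n - 1) * (1 - q ^ n)
      / ((1 + a * q ^ (2 * n - 1)) * (1 + a * q ^ (2 * n)))

/-- Monic `q`-Bessel polynomials `B_n(x;a|q)`. -/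
def qBessel (q a : ℂ) : ℕ → ℂ[X] :=
  ttrrSeq (fun n => qBesselA q a n + qBesselC q a n)
    (fun n => qBesselA q a n * qBesselC q a (n + 1))

/-- The monic polynomials `j_n(x;a,b|q)` of Medem and Álvarez-Nodarse; for `n = 0` the common factors
`1 - a / q` in `β_0` and `1 - a` in `γ_1` are cancelled. -/
def smallJ (q a b : ℂ) : ℕ → ℂ[X] :=
  ttrrSeq
    (fun n => if n = 0 then -a * b * q / (1 - a * q) else
      a * b * q ^ n * (1 + a * q ^ (2 * n) - (1 + q) * q ^ n)
        / ((1 - a * q ^ (2 * n - 1)) * (1 - a * q ^ (2 * n + 1))))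
    (fun n => if n = 0 then -a ^ 2 * b ^ 2 * q ^ 2 * (1 - q)
        / ((1 - a * q) ^ 2 * (1 - a * q ^ 2)) else
      -a ^ 2 * b ^ 2 * q ^ (3 * n + 2) * (1 - q ^ (n + 1)) * (1 - a * q ^ n)
        / ((1 - a * q ^ (2 * n)) * (1 - a * q ^ (2 * n + 1)) ^ 2 * (1 - a * q ^ (2 * n + 2))))

/-- The table of monic `q`-classical orthogonal polynomial sequences with base `q`. -/
inductive IsQClassical (q : ℂ) : (ℕ → ℂ[X]) → Prop
  | alSalamCarlitz (a : ℂ) (ha : a ≠ 0) : IsQClassical q (alSalamCarlitz q a)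
  | bigQLaguerre (a b : ℂ) (hab : a * b ≠ 0) (ha : a ∉ LambdaSet q) (hb : b ∉ LambdaSet q) :
      IsQClassical q (bigQLaguerre q a b)
  | littleQLaguerre (a : ℂ) (ha : a ≠ 0) (ha' : a ∉ LambdaSet q) :
      IsQClassical q (littleQLaguerre q a)
  | smallL (a : ℂ) (ha : a ≠ 0) : IsQClassical q (smallL q a)
  | bigQJacobi (a b c : ℂ) (hac : a * c ≠ 0) (ha : a ∉ LambdaSet q) (hb : b ∉ LambdaSet q)
      (hc : c ∉ LambdaSet q) (habq : a * b * q ∉ LambdaSet q) (habc : a * b * c⁻¹ ∉ LambdaSet q) :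
      IsQClassical q (bigQJacobi q a b c)
  | littleQJacobi (a b : ℂ) (ha : a ≠ 0) (ha' : a ∉ LambdaSet q) (hb : b ∉ LambdaSet q)
      (habq : a * b * q ∉ LambdaSet q) : IsQClassical q (littleQJacobi q a b)
  | qBessel (a : ℂ) (ha : a ≠ 0) (ha' : -a ∉ LambdaSet q) : IsQClassical q (qBessel q a)
  | smallJ (a b : ℂ) (hab : a * b ≠ 0) (ha : a ∉ LambdaSet q) : IsQClassical q (smallJ q a b)

/-- The monic sequence `r ^ n R_n((x - s) / r)`, obtained from the monic sequence `R` by the affine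
change of variable `x ↦ (x - s) / r`, `r ≠ 0`. -/
def affineSeq (r s : ℂ) (R : ℕ → ℂ[X]) (n : ℕ) : ℂ[X] :=
  C (r ^ n) * (R n).comp (C r⁻¹ * (X - C s))

end

/-! The point ω/(1-q) is fixed by x ↦ qx + ω, so translating by it reduces everything to ω = 0 and
the q-derivative D_q. The two sides of the equivalence are linked by a second-order operator L with
x²(Lh)(x) = a(x)(h(qx) - h(x)) + q b(x)(h(x/q) - h(x)), where a and b have degree at most 2 and a(0)
= b(0). A monic OPS satisfies (a) exactly when its members are eigenpolynomials of such an L with a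
≠ 0 and pairwise distinct eigenvalues (`exists_eigen_of_selfCoherent`, `selfCoherent_of_eigen`).
Both directions go through the Pearson equation of u, which makes L symmetric for the form (f, g) ↦
u(fg) (`IsPearson.mul_qHyp`).

Distinct eigenvalues make monic eigenpolynomials unique, so the pair (a, b) determines the sequence.
The eigenpolynomials exist and obey a three-term recurrence because L and multiplication by x
satisfy a cubic relation (`qHyp_relation`, `ttrrSeq_eigen`). The recurrence coefficients are then
read off from the two coefficients below the leading one, as rational functions of q^n.

It remains to classify pairs. A constant factor on the pair is harmless, rescaling x rescales the
sequence (`ttrrSeq_scale`), and exchanging a with b inverts q (`qHyp_swap`), which is why both bases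
occur. Orthogonality forces all γ to be nonzero; this excludes degenerate pairs and gives the
parameter conditions of the table. Five normal forms remain: big q-Jacobi, Al-Salam–Carlitz, little
q-Jacobi, q-Bessel and l_n. The q-Laguerre rows are q-Jacobi rows with a zero parameter, and the
pair of j_n becomes a q-Bessel pair when swapped, so these three rows matter only for the
implication from (b) to (a). -/

noncomputable section

/-! ### The q-derivative -/

/-- The `q`-derivative `X ^ n ↦ [n]_q X ^ (n - 1)`. -/
def qDeriv (q : ℂ) : ℂ[X] →ₗ[ℂ] ℂ[X] :=
  Polynomial.lsum fun n => qNumber q n • monomial (n - 1)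

theorem qNumber_zero (q : ℂ) : qNumber q 0 = 0 := by simp [qNumber]

theorem coeff_qDeriv (q : ℂ) (f : ℂ[X]) (k : ℕ) :
    (qDeriv q f).coeff k = qNumber q (k + 1) * f.coeff (k + 1) := by
  induction f using Polynomial.induction_on' with
  | add f g hf hg => simp [hf, hg, mul_add]
  | monomial n c =>
    rcases n with _ | n
    · simp [qDeriv, qNumber_zero]
    · by_cases h : n = k <;> simp [qDeriv, coeff_monomial, h]

theorem mul_qDeriv {q : ℂ} (hq : q ≠ 1) (f : ℂ[X]) :
    C (q - 1) * X * qDeriv q f = f.comp (C q * X) - f := by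
  have h1 : q - 1 ≠ 0 := sub_ne_zero.mpr hq
  ext k
  rw [mul_assoc, coeff_C_mul, coeff_sub, comp_C_mul_X_coeff]
  rcases k with _ | k
  · simp
  · rw [coeff_X_mul, coeff_qDeriv, qNumber]
    field_simp

theorem hahnD_zero_eq_qDeriv {q : ℂ} (hq : q ≠ 1) (f : ℂ[X]) : hahnD q 0 f = qDeriv q f := by
  have h1 : q - 1 ≠ 0 := sub_ne_zero.mpr hq
  have h := hahnD_mul q 0 hq f
  simp only [C_0, add_zero] at h
  rw [← mul_qDeriv hq f] at h
  exact mul_left_cancel₀ (mul_ne_zero (C_ne_zero.mpr h1) X_ne_zero) h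

/-- The dilation is put on g so that for g = D_{1/q} h it turns into D_q h, by `qDeriv_inv_comp`. -/
theorem qDeriv_mul {q : ℂ} (hq : q ≠ 1) (f g : ℂ[X]) :
    qDeriv q (f * g) = f * qDeriv q g + g.comp (C q * X) * qDeriv q f := by
  have h1 : q - 1 ≠ 0 := sub_ne_zero.mpr hq
  refine mul_left_cancel₀ (mul_ne_zero (C_ne_zero.mpr h1) X_ne_zero) ?_
  have e1 := mul_qDeriv hq (f * g)
  rw [mul_comp] at e1
  linear_combination e1 - f * mul_qDeriv hq g - g.comp (C q * X) * mul_qDeriv hq f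

/-- Both sides are the quotient (f(qx) - f(x)) / ((q-1)x). -/
theorem qDeriv_inv_comp {q : ℂ} (hq0 : q ≠ 0) (hq : q ≠ 1) (f : ℂ[X]) :
    (qDeriv q⁻¹ f).comp (C q * X) = qDeriv q f := by
  have h1 : q - 1 ≠ 0 := sub_ne_zero.mpr hq
  have h2 : q⁻¹ - 1 ≠ 0 := sub_ne_zero.mpr (by simpa using hq)
  have h3 : 1 - q ≠ 0 := sub_ne_zero.mpr hq.symm
  ext k
  rw [comp_C_mul_X_coeff, coeff_qDeriv, coeff_qDeriv]
  have : qNumber q⁻¹ (k + 1) * q ^ k = qNumber q (k + 1) := by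
    unfold qNumber
    rw [inv_pow, pow_succ]
    field_simp
    ring
  rw [← this]; ring

/-! ### The q-difference operator, its eigenvalues and the cubic relation -/

/-- Coefficients of a pair of polynomials `a = a0 + a1 x + a2 x²`, `b = a0 + b1 x + b2 x²` with a
common constant term, which define the `q`-difference operator `qHyp`. -/
structure QPair where
  a0 : ℂ
  a1 : ℂ
  a2 : ℂ
  b1 : ℂ
  b2 : ℂ

/-- The first polynomial of the pair. -/
def QPair.polyA (d : QPair) : ℂ[X] := C d.a0 + C d.a1 * X + C d.a2 * X ^ 2

/-- The polynomial `(b - a) / x`. -/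
def QPair.polyPsi (d : QPair) : ℂ[X] := C (d.b1 - d.a1) + C (d.b2 - d.a2) * X

/-- The operator `L` with `x² (L h)(x) = a(x) (h(qx) - h(x)) + q b(x) (h(x/q) - h(x))`. -/
def qHyp (q : ℂ) (d : QPair) : ℂ[X] →ₗ[ℂ] ℂ[X] :=
  (q - 1) ^ 2 • (LinearMap.mulLeft ℂ d.polyA ∘ₗ qDeriv q ∘ₗ qDeriv q⁻¹)
    - (q - 1) • (LinearMap.mulLeft ℂ d.polyPsi ∘ₗ qDeriv q⁻¹)

/-- One has (q-1)²x² D_q D_{1/q} h = h(qx) - h(x) + q(h(x/q) - h(x)) and -(q-1)x D_{1/q} h =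
q(h(x/q) - h(x)). The common constant term makes b - a divisible by x, so L preserves polynomials.
-/
theorem qHyp_apply (q : ℂ) (d : QPair) (f : ℂ[X]) :
    qHyp q d f = C ((q - 1) ^ 2) * (d.polyA * qDeriv q (qDeriv q⁻¹ f))
      - C (q - 1) * (d.polyPsi * qDeriv q⁻¹ f) := by
  simp [qHyp, smul_eq_C_mul]

/-- The eigenvalue of `qHyp` in degree `n`. -/
def QPair.eig (q : ℂ) (d : QPair) (n : ℕ) : ℂ := (q ^ n - 1) * (d.a2 - d.b2 * q / q ^ n)

/-- The coefficient of `X ^ (n - 1)` in the image of `X ^ n` under `qHyp`. -/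
def QPair.eig₁ (q : ℂ) (d : QPair) (n : ℕ) : ℂ := (q ^ n - 1) * (d.a1 - d.b1 * q / q ^ n)

/-- The coefficient of `X ^ (n - 2)` in the image of `X ^ n` under `qHyp`. -/
def QPair.eig₂ (q : ℂ) (d : QPair) (n : ℕ) : ℂ := (q ^ n - 1) * (1 - q / q ^ n) * d.a0

/-- L sends x^n to x^(n-2) times (q^n - 1)a(x) + q(q^(-n) - 1)b(x). No negative powers arise, since
`eig₁` vanishes at 0 and `eig₂` at 0 and 1. -/
theorem coeff_qHyp {q : ℂ} (hq0 : q ≠ 0) (hq : q ≠ 1) (d : QPair) (f : ℂ[X]) (k : ℕ) :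
    (qHyp q d f).coeff k = d.eig q k * f.coeff k + d.eig₁ q (k + 1) * f.coeff (k + 1)
      + d.eig₂ q (k + 2) * f.coeff (k + 2) := by
  have h1 : q - 1 ≠ 0 := sub_ne_zero.mpr hq
  have h2 : q⁻¹ - 1 ≠ 0 := sub_ne_zero.mpr (by simpa using hq)
  have h3 : 1 - q ≠ 0 := sub_ne_zero.mpr hq.symm
  rw [qHyp_apply]
  simp only [QPair.polyA, QPair.polyPsi, add_mul, coeff_sub, coeff_C_mul, coeff_add, mul_assoc,
    coeff_qDeriv]
  rcases k with _ | _ | k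
  · simp [coeff_qDeriv, qNumber, QPair.eig, QPair.eig₁, QPair.eig₂]
    field_simp
    ring
  · simp [coeff_X_pow_mul', coeff_X_mul, coeff_qDeriv, qNumber, QPair.eig, QPair.eig₁, QPair.eig₂]
    field_simp
    ring
  · simp only [coeff_X_mul, coeff_qDeriv, qNumber, QPair.eig, QPair.eig₁,
      QPair.eig₂, inv_pow, pow_succ, pow_zero, one_mul, mul_assoc]
    field_simp
    ring

theorem qHyp_one {q : ℂ} (hq0 : q ≠ 0) (hq : q ≠ 1) (d : QPair) : qHyp q d 1 = 0 := by
  ext k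
  rw [coeff_qHyp hq0 hq]
  rcases k with _ | k <;> simp [coeff_one, QPair.eig]

/-- The cubic (Askey–Wilson type) relation between `qHyp` and multiplication by `X`. -/
theorem qHyp_relation {q : ℂ} (hq0 : q ≠ 0) (hq : q ≠ 1) (d : QPair) (f : ℂ[X]) (κ : ℂ)
    (hκ : κ = d.a2 + d.b2 * q) :
    qHyp q d (qHyp q d (X * f)) + C (2 * κ) * qHyp q d (X * f) + C (κ ^ 2) * (X * f)
      - C (q + q⁻¹) * (qHyp q d (X * qHyp q d f) + C κ * qHyp q d (X * f)
        + C κ * (X * qHyp q d f) + C (κ ^ 2) * (X * f))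
      + (X * qHyp q d (qHyp q d f) + C (2 * κ) * (X * qHyp q d f) + C (κ ^ 2) * (X * f))
      + C (d.a2 * d.b2 * (q ^ 3 + q⁻¹ - 2 * q)) * (X * f)
      = C ((q - 1) ^ 2 * (d.a1 + d.b1 * q) / q) * (qHyp q d f + C κ * f)
        - C ((q - 1) ^ 2 * (q + 1) * (d.a1 * d.b2 + d.a2 * d.b1 / q)) * f := by
  -- With M = L + κ the left side is M²X - (q + 1/q)MXM + XM² plus a multiple of X. The shift κ
  -- makes the eigenvalues a2 q^n + b2 q^(1-n). All operators are banded in the monomial basis, so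
  -- the relation is an identity in z = q^k on each coefficient.
  subst hκ
  ext k
  simp only [coeff_add, coeff_sub, coeff_C_mul, coeff_qHyp hq0 hq]
  rcases k with _ | k
  · simp only [coeff_X_mul, coeff_X_mul_zero, coeff_qHyp hq0 hq, QPair.eig, QPair.eig₁, QPair.eig₂,
      pow_succ, pow_zero]
    field_simp
    ring
  · simp only [coeff_X_mul, coeff_qHyp hq0 hq, QPair.eig, QPair.eig₁, QPair.eig₂,
      pow_succ, pow_zero]
    have hz : q ^ k ≠ 0 := pow_ne_zero _ hq0
    generalize q ^ k = z at *
    field_simp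
    ring

theorem pow_ne_pow_of_ne {q : ℂ} (hq0 : q ≠ 0) (hq : ∀ n : ℕ, 1 ≤ n → q ^ n ≠ 1) {m n : ℕ}
    (h : m ≠ n) : q ^ m ≠ q ^ n := by
  wlog hlt : m < n generalizing m n
  · exact (this h.symm (by omega)).symm
  obtain ⟨k, rfl⟩ := Nat.exists_eq_add_of_lt hlt
  intro he
  rw [add_assoc, pow_add] at he
  exact hq (k + 1) (by omega) (mul_left_cancel₀ (pow_ne_zero m hq0) (by rw [mul_one]; exact he.symm))

/-- Admissibility: the eigenvalues of `qHyp` are pairwise distinct. -/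
def QPair.Admissible (q : ℂ) (d : QPair) : Prop := ∀ k : ℕ, d.a2 * q ^ k ≠ d.b2

/-- The difference of two eigenvalues factors as (q^m - q^n)(a2 - b2 q / q^(m+n)); admissibility is
used at exponent m + n - 1. -/
theorem QPair.eig_injective {q : ℂ} (hq0 : q ≠ 0) (hq : ∀ n : ℕ, 1 ≤ n → q ^ n ≠ 1) {d : QPair}
    (hd : d.Admissible q) : Function.Injective (d.eig q) := by
  intro m n h
  by_contra hmn
  obtain ⟨k, hk⟩ : ∃ k, m + n = k + 1 := ⟨m + n - 1, by omega⟩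
  have h1 : (q ^ m - q ^ n) * (d.a2 - d.b2 * q / q ^ (m + n)) = 0 := by
    have hm := pow_ne_zero m hq0
    have hn := pow_ne_zero n hq0
    unfold QPair.eig at h
    rw [pow_add]
    field_simp at h ⊢
    linear_combination h
  rcases mul_eq_zero.mp h1 with h2 | h2
  · exact pow_ne_pow_of_ne hq0 hq hmn (sub_eq_zero.mp h2)
  · apply hd k
    rw [hk, pow_succ] at h2
    have := pow_ne_zero k hq0
    field_simp at h2
    linear_combination h2

theorem natDegree_qHyp_le {q : ℂ} (hq0 : q ≠ 0) (hq : q ≠ 1) (d : QPair) (f : ℂ[X]) :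
    (qHyp q d f).natDegree ≤ f.natDegree := by
  rw [natDegree_le_iff_coeff_eq_zero]
  intro k hk
  rw [coeff_qHyp hq0 hq, coeff_eq_zero_of_natDegree_lt hk,
    coeff_eq_zero_of_natDegree_lt (hk.trans (by omega)),
    coeff_eq_zero_of_natDegree_lt (hk.trans (by omega))]
  simp

theorem coeff_natDegree_qHyp {q : ℂ} (hq0 : q ≠ 0) (hq : q ≠ 1) (d : QPair) (f : ℂ[X]) :
    (qHyp q d f).coeff f.natDegree = d.eig q f.natDegree * f.leadingCoeff := by
  rw [coeff_qHyp hq0 hq, coeff_eq_zero_of_natDegree_lt (n := f.natDegree + 1) (by omega),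
    coeff_eq_zero_of_natDegree_lt (n := f.natDegree + 2) (by omega)]
  simp

theorem eq_eig_of_eigen {q : ℂ} (hq0 : q ≠ 0) (hq : q ≠ 1) (d : QPair) {f : ℂ[X]} (hf : f ≠ 0)
    {m : ℂ} (h : qHyp q d f = C m * f) : m = d.eig q f.natDegree := by
  have h1 := coeff_natDegree_qHyp hq0 hq d f
  rw [h, coeff_C_mul] at h1
  exact mul_right_cancel₀ (leadingCoeff_ne_zero.mpr hf) h1

/-- The difference of the two sides is an eigenvector without X^n term. If it were nonzero, its
degree would be n because the eigenvalue determines the degree. -/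
theorem eigen_eq_smul {q : ℂ} (hq0 : q ≠ 0) (hq : ∀ n : ℕ, 1 ≤ n → q ^ n ≠ 1) {d : QPair}
    (hd : d.Admissible q) {n : ℕ} {f g : ℂ[X]} (hg : g.Monic) (hgn : g.natDegree = n)
    (hge : qHyp q d g = C (d.eig q n) * g) (hfe : qHyp q d f = C (d.eig q n) * f) :
    f = C (f.coeff n) * g := by
  have hq1 : q ≠ 1 := by simpa using hq 1 le_rfl
  by_contra hne
  have h0 : f - C (f.coeff n) * g ≠ 0 := sub_ne_zero.mpr hne
  have he : qHyp q d (f - C (f.coeff n) * g) = C (d.eig q n) * (f - C (f.coeff n) * g) := by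
    rw [map_sub, hfe, ← smul_eq_C_mul (p := g), map_smul, hge, smul_eq_C_mul, smul_eq_C_mul]
    ring
  have h1 := QPair.eig_injective hq0 hq hd (eq_eig_of_eigen hq0 hq1 d h0 he)
  have h2 : (f - C (f.coeff n) * g).coeff n = 0 := by
    have : g.coeff n = 1 := by rw [← hgn]; exact hg
    rw [coeff_sub, coeff_C_mul, this]; ring
  exact h0 (leadingCoeff_eq_zero.mp (by rw [leadingCoeff, ← h1]; exact h2))

/-! ### The recurrence of the eigenpolynomials -/

/-- The coefficient of `X ^ (n - 1)` in the monic eigenpolynomial of degree `n`, where `z = q ^ n`. -/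
def QPair.sub₁ (q : ℂ) (d : QPair) (z : ℂ) : ℂ :=
  q * (z - 1) * (d.a1 * z - d.b1 * q) / ((q - 1) * (d.a2 * z ^ 2 - d.b2 * q ^ 2))

/-- The coefficient of `X ^ (n - 2)` in the monic eigenpolynomial of degree `n`, where `z = q ^ n`. -/
def QPair.sub₂ (q : ℂ) (d : QPair) (z : ℂ) : ℂ :=
  q ^ 2 * (z - q) * ((d.a1 * z - d.b1 * q ^ 2) * d.sub₁ q z / q + d.a0 * (z - 1))
    / ((q ^ 2 - 1) * (d.a2 * z ^ 2 - d.b2 * q ^ 3))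

/-- The recurrence coefficient `β_n` of the monic eigenpolynomials. -/
def QPair.beta (q : ℂ) (d : QPair) (n : ℕ) : ℂ := d.sub₁ q (q ^ n) - d.sub₁ q (q ^ (n + 1))

/-- The recurrence coefficient `γ_{n+1}` of the monic eigenpolynomials. -/
def QPair.gamma (q : ℂ) (d : QPair) (n : ℕ) : ℂ :=
  d.sub₂ q (q ^ (n + 1)) - d.sub₂ q (q ^ (n + 2)) - d.beta q (n + 1) * d.sub₁ q (q ^ (n + 1))

/-- Up to nonzero factors this is the eigenvalue gap between degrees n + 1 and n, and `denom₂` is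
the gap between n + 2 and n. -/
theorem QPair.Admissible.denom₁ {q : ℂ} (hq0 : q ≠ 0) {d : QPair} (hd : d.Admissible q) (n : ℕ) :
    d.a2 * (q ^ (n + 1)) ^ 2 - d.b2 * q ^ 2 ≠ 0 := by
  intro h
  apply hd (2 * n)
  have : q ^ 2 * (d.a2 * q ^ (2 * n) - d.b2) = 0 := by
    linear_combination h
  rcases mul_eq_zero.mp this with h1 | h1
  · exact absurd h1 (pow_ne_zero 2 hq0)
  · exact sub_eq_zero.mp h1

theorem QPair.Admissible.denom₂ {q : ℂ} (hq0 : q ≠ 0) {d : QPair} (hd : d.Admissible q) (n : ℕ) :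
    d.a2 * (q ^ (n + 2)) ^ 2 - d.b2 * q ^ 3 ≠ 0 := by
  intro h
  apply hd (2 * n + 1)
  have : q ^ 3 * (d.a2 * q ^ (2 * n + 1) - d.b2) = 0 := by
    linear_combination h
  rcases mul_eq_zero.mp this with h1 | h1
  · exact absurd h1 (pow_ne_zero 3 hq0)
  · exact sub_eq_zero.mp h1

theorem coeff_eigen₁ {q : ℂ} (hq0 : q ≠ 0) (hq : ∀ n : ℕ, 1 ≤ n → q ^ n ≠ 1) {d : QPair}
    (hd : d.Admissible q) {n : ℕ} {f : ℂ[X]} (hf : f.Monic) (hfn : f.natDegree = n + 1)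
    (hfe : qHyp q d f = C (d.eig q (n + 1)) * f) : f.coeff n = d.sub₁ q (q ^ (n + 1)) := by
  have hq1 : q ≠ 1 := by simpa using hq 1 le_rfl
  have h1 : q - 1 ≠ 0 := sub_ne_zero.mpr hq1
  have h := congrArg (fun g => g.coeff n) hfe
  simp only [coeff_qHyp hq0 hq1, coeff_C_mul] at h
  have e1 : f.coeff (n + 1) = 1 := by rw [← hfn]; exact hf
  rw [e1, coeff_eq_zero_of_natDegree_lt (n := n + 2) (by omega)] at h
  have hz : q ^ n ≠ 0 := pow_ne_zero _ hq0
  have hden := hd.denom₁ hq0 n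
  unfold QPair.sub₁
  rw [eq_div_iff (mul_ne_zero h1 hden)]
  simp only [QPair.eig, QPair.eig₁, pow_succ] at h ⊢
  generalize q ^ n = z at *
  field_simp at h
  linear_combination -q ^ 2 * h

theorem coeff_eigen₂ {q : ℂ} (hq0 : q ≠ 0) (hq : ∀ n : ℕ, 1 ≤ n → q ^ n ≠ 1) {d : QPair}
    (hd : d.Admissible q) {n : ℕ} {f : ℂ[X]} (hf : f.Monic) (hfn : f.natDegree = n + 2)
    (hfe : qHyp q d f = C (d.eig q (n + 2)) * f) : f.coeff n = d.sub₂ q (q ^ (n + 2)) := by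
  have hq1 : q ≠ 1 := by simpa using hq 1 le_rfl
  have h1 : q ^ 2 - 1 ≠ 0 := sub_ne_zero.mpr (hq 2 (by norm_num))
  have h := congrArg (fun g => g.coeff n) hfe
  simp only [coeff_qHyp hq0 hq1, coeff_C_mul] at h
  have e1 : f.coeff (n + 2) = 1 := by rw [← hfn]; exact hf
  rw [e1, coeff_eigen₁ hq0 hq hd hf hfn hfe] at h
  have hz : q ^ n ≠ 0 := pow_ne_zero _ hq0
  have hden := hd.denom₂ hq0 n
  unfold QPair.sub₂
  rw [eq_div_iff (mul_ne_zero h1 hden)]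
  generalize d.sub₁ q (q ^ (n + 2)) = s at *
  simp only [QPair.eig, QPair.eig₁, QPair.eig₂, pow_succ] at h ⊢
  generalize q ^ n = z at *
  field_simp at h ⊢
  linear_combination -h

theorem ttrrSeq_monic (β γ : ℕ → ℂ) :
    ∀ n, (ttrrSeq β γ n).Monic ∧ (ttrrSeq β γ n).natDegree = n
  | 0 => by simp [ttrrSeq]
  | 1 => by simp [ttrrSeq, monic_X_sub_C]
  | n + 2 => by
    obtain ⟨m1, d1⟩ := ttrrSeq_monic β γ n
    obtain ⟨m2, d2⟩ := ttrrSeq_monic β γ (n + 1)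
    have hm := (monic_X_sub_C (β (n + 1))).mul m2
    have hd : ((X - C (β (n + 1))) * ttrrSeq β γ (n + 1)).natDegree = n + 2 := by
      rw [(monic_X_sub_C _).natDegree_mul m2, natDegree_X_sub_C, d2]; ring
    have hlt : (C (γ n) * ttrrSeq β γ n).natDegree
        < ((X - C (β (n + 1))) * ttrrSeq β γ (n + 1)).natDegree := by
      rw [hd]
      exact (natDegree_C_mul_le _ _).trans_lt (by omega)
    refine ⟨hm.sub_of_left (degree_lt_degree hlt), ?_⟩
    rw [ttrrSeq, natDegree_sub_eq_left_of_natDegree_lt hlt, hd]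

/-- Let μ₀, μ₁, μ₂ be the eigenvalues in degrees n, n+1, n+2, and f, g the eigenpolynomials in
degrees n, n+1. The cubic relation gives (L - μ₀)(L - μ₂)(xg) = const · g, and a suitable β gives (L
- μ₀)(L - μ₂)((x - β)g) = 0. Then (L - μ₂)((x - β)g) lies in the μ₀-eigenspace, so it is a multiple
of f, and subtracting a multiple of f from (x - β)g leaves a μ₂-eigenvector. -/
theorem ttrrSeq_eigen {q : ℂ} (hq0 : q ≠ 0) (hq : ∀ n : ℕ, 1 ≤ n → q ^ n ≠ 1) {d : QPair}
    (hd : d.Admissible q) :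
    ∀ n, qHyp q d (ttrrSeq (d.beta q) (d.gamma q) n)
      = C (d.eig q n) * ttrrSeq (d.beta q) (d.gamma q) n
  | 0 => by
    have hq1 : q ≠ 1 := by simpa using hq 1 le_rfl
    simp [ttrrSeq, qHyp_one hq0 hq1, QPair.eig]
  | 1 => by
    have hq1 : q ≠ 1 := by simpa using hq 1 le_rfl
    have h1 : q - 1 ≠ 0 := sub_ne_zero.mpr hq1
    have hs : (d.a2 - d.b2) * d.sub₁ q q = d.a1 - d.b1 := by
      have hden : d.a2 - d.b2 ≠ 0 := sub_ne_zero.mpr (by simpa using hd 0)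
      have e : d.a2 * q ^ 2 - d.b2 * q ^ 2 = (d.a2 - d.b2) * q ^ 2 := by ring
      unfold QPair.sub₁
      rw [e]
      field_simp
    have hb : d.beta q 0 = -d.sub₁ q q := by simp [QPair.beta, QPair.sub₁]
    ext k
    simp only [ttrrSeq, coeff_qHyp hq0 hq1, coeff_C_mul, coeff_sub, hb]
    rcases k with _ | _ | k
    · simp [QPair.eig, QPair.eig₁, coeff_X, coeff_C]
      field_simp
      linear_combination -hs
    · simp [coeff_X]
    · simp [coeff_X]
  | n + 2 => by
    have hq1 : q ≠ 1 := by simpa using hq 1 le_rfl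
    have inj := QPair.eig_injective hq0 hq hd
    have e0 := ttrrSeq_eigen hq0 hq hd n
    have e1 := ttrrSeq_eigen hq0 hq hd (n + 1)
    obtain ⟨m0, d0⟩ := ttrrSeq_monic (d.beta q) (d.gamma q) n
    obtain ⟨m1, d1⟩ := ttrrSeq_monic (d.beta q) (d.gamma q) (n + 1)
    rw [ttrrSeq]
    set f := ttrrSeq (d.beta q) (d.gamma q) n
    set g := ttrrSeq (d.beta q) (d.gamma q) (n + 1)
    obtain ⟨β, hβ⟩ : ∃ β, qHyp q d (qHyp q d ((X - C β) * g)) - C (d.eig q n + d.eig q (n + 2))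
        * qHyp q d ((X - C β) * g)
        + C (d.eig q n * d.eig q (n + 2)) * ((X - C β) * g) = 0 := by
      have hrel := qHyp_relation hq0 hq1 d g _ rfl
      -- The next two identities say that the shifted eigenvalues μ₀ + κ and μ₂ + κ are the roots of
      -- the quadratic that the cubic relation attaches to μ₁ + κ.
      have hz : q ^ n ≠ 0 := pow_ne_zero _ hq0
      have hsum : d.eig q n + d.eig q (n + 2)
          = (q + q⁻¹) * (d.eig q (n + 1) + (d.a2 + d.b2 * q)) - 2 * (d.a2 + d.b2 * q) := by
        simp only [QPair.eig, pow_succ]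
        field_simp
        ring
      have hprod : d.eig q n * d.eig q (n + 2)
          = (d.a2 + d.b2 * q) ^ 2
            - (q + q⁻¹) * (d.eig q (n + 1) + (d.a2 + d.b2 * q)) * (d.a2 + d.b2 * q)
            + (d.eig q (n + 1) + (d.a2 + d.b2 * q)) ^ 2
            + d.a2 * d.b2 * (q ^ 3 + q⁻¹ - 2 * q) := by
        simp only [QPair.eig, pow_succ]
        field_simp
        ring
      have hn0 : d.eig q (n + 1) - d.eig q n ≠ 0 :=
        sub_ne_zero.mpr fun h => absurd (inj h) (by omega)
      have hn2 : d.eig q (n + 1) - d.eig q (n + 2) ≠ 0 :=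
        sub_ne_zero.mpr fun h => absurd (inj h) (by omega)
      generalize d.a2 + d.b2 * q = κ at *
      generalize (q - 1) ^ 2 * (d.a1 + d.b1 * q) / q = c₂ at *
      generalize (q - 1) ^ 2 * (q + 1) * (d.a1 * d.b2 + d.a2 * d.b1 / q) = c₃ at *
      generalize d.a2 * d.b2 * (q ^ 3 + q⁻¹ - 2 * q) = c₄ at *
      generalize q + q⁻¹ = w at *
      generalize d.eig q n = μ₀ at *
      generalize d.eig q (n + 1) = μ₁ at *
      generalize d.eig q (n + 2) = μ₂ at *
      -- On g the operator (L - μ₀)(L - μ₂) is the scalar (μ₁ - μ₀)(μ₁ - μ₂), nonzero by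
      -- distinctness, so β can be solved for.
      obtain ⟨β, hβ⟩ : ∃ β, c₂ * (μ₁ + κ) - c₃ = β * ((μ₁ - μ₀) * (μ₁ - μ₂)) :=
        ⟨(c₂ * (μ₁ + κ) - c₃) / ((μ₁ - μ₀) * (μ₁ - μ₂)), by field_simp⟩
      refine ⟨β, ?_⟩
      have eC : ∀ (c : ℂ) (p : ℂ[X]), qHyp q d (C c * p) = C c * qHyp q d p := fun c p => by
        rw [← smul_eq_C_mul, map_smul, smul_eq_C_mul]
      have hcomm : X * (C μ₁ * g) = C μ₁ * (X * g) := by ring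
      rw [e1, hcomm, eC, eC, e1] at hrel
      rw [sub_mul, map_sub, map_sub, eC, eC, e1, eC, e1]
      have hβ' := congrArg (fun c => C c * g) hβ
      have hsum' := congrArg (fun c => C c * (qHyp q d (X * g))) hsum
      have hprod' := congrArg (fun c => C c * (X * g)) hprod
      have hC2 : (C 2 : ℂ[X]) = 2 := map_ofNat C 2
      simp only [C_add, C_sub, C_mul, C_pow, hC2] at hrel hβ' hsum' hprod' ⊢
      linear_combination hrel + hβ' - hsum' + hprod'
    have hy : qHyp q d (qHyp q d ((X - C β) * g) - C (d.eig q (n + 2)) * ((X - C β) * g))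
        = C (d.eig q n) * (qHyp q d ((X - C β) * g) - C (d.eig q (n + 2)) * ((X - C β) * g)) := by
      rw [map_sub, ← smul_eq_C_mul (p := (X - C β) * g), map_smul, smul_eq_C_mul, smul_eq_C_mul]
      simp only [C_add, C_mul] at hβ
      linear_combination hβ
    have hy' := eigen_eq_smul hq0 hq hd m0 d0 e0 hy
    generalize (qHyp q d ((X - C β) * g) - C (d.eig q (n + 2)) * ((X - C β) * g)).coeff n = κ at hy'
    have hne : d.eig q n - d.eig q (n + 2) ≠ 0 :=
      sub_ne_zero.mpr fun h => absurd (inj h) (by omega)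
    set γ := κ / (d.eig q n - d.eig q (n + 2)) with hγ
    have hκ : κ = γ * (d.eig q n - d.eig q (n + 2)) := by rw [hγ]; field_simp
    have hh : qHyp q d ((X - C β) * g - C γ * f)
        = C (d.eig q (n + 2)) * ((X - C β) * g - C γ * f) := by
      rw [map_sub, ← smul_eq_C_mul (p := f), map_smul, e0, smul_eq_C_mul, smul_eq_C_mul]
      rw [hκ, C_mul, C_sub] at hy'
      linear_combination hy'
    have hmd : ((X - C β) * g - C γ * f).Monic ∧ ((X - C β) * g - C γ * f).natDegree = n + 2 := by
      have hm := (monic_X_sub_C β).mul m1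
      have hdeg : ((X - C β) * g).natDegree = n + 2 := by
        rw [(monic_X_sub_C _).natDegree_mul m1, natDegree_X_sub_C, d1]; ring
      have hlt : (C γ * f).natDegree < ((X - C β) * g).natDegree := by
        rw [hdeg]
        exact (natDegree_C_mul_le _ _).trans_lt (by omega)
      refine ⟨hm.sub_of_left (degree_lt_degree hlt), ?_⟩
      rw [natDegree_sub_eq_left_of_natDegree_lt hlt, hdeg]
    have g1 : g.coeff (n + 1) = 1 := by rw [← d1]; exact m1
    have f1 : f.coeff n = 1 := by rw [← d0]; exact m0
    have hb : β = d.beta q (n + 1) := by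
      have h2 := coeff_eigen₁ hq0 hq hd hmd.1 hmd.2 hh
      rw [coeff_sub, sub_mul, coeff_sub, coeff_X_mul, coeff_C_mul, coeff_C_mul, g1,
        coeff_eq_zero_of_natDegree_lt (p := f) (by omega), coeff_eigen₁ hq0 hq hd m1 d1 e1] at h2
      rw [QPair.beta]
      linear_combination -h2
    have hg : γ = d.gamma q n := by
      have h2 := coeff_eigen₂ hq0 hq hd hmd.1 hmd.2 hh
      rw [coeff_sub, sub_mul, coeff_sub, coeff_C_mul, coeff_C_mul, f1,
        coeff_eigen₁ hq0 hq hd m1 d1 e1, hb] at h2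
      rw [QPair.gamma, ← h2]
      -- For n = 0 the polynomial X * g has no constant term; this agrees with the formula because
      -- `sub₂` vanishes at z = q.
      rcases n with _ | n
      · simp [QPair.sub₂]
      · rw [coeff_X_mul, coeff_eigen₂ hq0 hq hd m1 d1 e1]
        ring
    rw [← hb, ← hg]
    exact hh

theorem eigen_eq_ttrrSeq {q : ℂ} (hq0 : q ≠ 0) (hq : ∀ n : ℕ, 1 ≤ n → q ^ n ≠ 1) {d : QPair}
    (hd : d.Admissible q) {P : ℕ → ℂ[X]} (hP : ∀ n, (P n).Monic ∧ (P n).natDegree = n)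
    (he : ∀ n, qHyp q d (P n) = C (d.eig q n) * P n) : P = ttrrSeq (d.beta q) (d.gamma q) := by
  funext n
  obtain ⟨m, hm⟩ := ttrrSeq_monic (d.beta q) (d.gamma q) n
  have h := eigen_eq_smul hq0 hq hd m hm (ttrrSeq_eigen hq0 hq hd n) (he n)
  rw [h]
  have : (P n).coeff n = 1 := by
    nth_rw 2 [← (hP n).2]
    exact (hP n).1
  rw [this, C_1, one_mul]

/-! ### Expansion in an orthogonal sequence -/

theorem coeff_self_eq_one {P : ℕ → ℂ[X]} (hP : ∀ n, (P n).Monic ∧ (P n).natDegree = n) (n : ℕ) :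
    (P n).coeff n = 1 := by
  nth_rw 2 [← (hP n).2]
  exact (hP n).1

theorem exists_eq_sum_of_degree_lt {P : ℕ → ℂ[X]} (hP : ∀ n, (P n).Monic ∧ (P n).natDegree = n) :
    ∀ (n : ℕ) (f : ℂ[X]), f.degree < n → ∃ e : ℕ → ℂ, f = ∑ j ∈ Finset.range n, C (e j) * P j
  | 0, f, hf => ⟨0, by
      have : f = 0 := by simpa [Nat.WithBot.lt_zero_iff] using hf
      simp [this]⟩
  | n + 1, f, hf => by
    have hlt : (f - C (f.coeff n) * P n).degree < n := by
      rw [degree_lt_iff_coeff_zero] at hf ⊢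
      intro m hm
      rw [coeff_sub, coeff_C_mul]
      rcases hm.eq_or_lt with rfl | hm
      · have : (P n).coeff n = 1 := coeff_self_eq_one hP n
        rw [this]; ring
      · rw [hf m hm, coeff_eq_zero_of_natDegree_lt (p := P n) (by rw [(hP n).2]; exact hm)]
        ring
    obtain ⟨e, he⟩ := exists_eq_sum_of_degree_lt hP n _ hlt
    refine ⟨fun j => if j = n then f.coeff n else e j, ?_⟩
    simp only [Finset.sum_range_succ, if_true]
    rw [← sub_eq_iff_eq_add, he]
    refine Finset.sum_congr rfl fun j hj => ?_
    rw [if_neg (Finset.mem_range.mp hj).ne]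

theorem functional_eq_zero {P : ℕ → ℂ[X]} (hP : ∀ n, (P n).Monic ∧ (P n).natDegree = n)
    (v : ℂ[X] →ₗ[ℂ] ℂ) (hv : ∀ n, v (P n) = 0) (f : ℂ[X]) : v f = 0 := by
  obtain ⟨e, he⟩ := exists_eq_sum_of_degree_lt hP (f.natDegree + 1) f
    (degree_le_natDegree.trans_lt (by exact_mod_cast Nat.lt_succ_self _))
  rw [he, map_sum]
  refine Finset.sum_eq_zero fun j _ => ?_
  rw [← smul_eq_C_mul, map_smul, hv, smul_zero]

/-- The sequence `P` is orthogonal with respect to the functional `u`. -/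
def IsOrthogonal (u : ℂ[X] →ₗ[ℂ] ℂ) (P : ℕ → ℂ[X]) : Prop :=
  ∀ n m, (n ≠ m → u (P n * P m) = 0) ∧ (n = m → u (P n * P m) ≠ 0)

theorem map_C_mul (u : ℂ[X] →ₗ[ℂ] ℂ) (c : ℂ) (f : ℂ[X]) : u (C c * f) = c * u f := by
  rw [← smul_eq_C_mul, map_smul, smul_eq_mul]

theorem IsOrthogonal.mul_sum {u : ℂ[X] →ₗ[ℂ] ℂ} {P : ℕ → ℂ[X]} (hu : IsOrthogonal u P)
    (e : ℕ → ℂ) (s : Finset ℕ) (k : ℕ) :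
    u (P k * ∑ j ∈ s, C (e j) * P j) = if k ∈ s then e k * u (P k * P k) else 0 := by
  rw [Finset.mul_sum, map_sum]
  have : ∀ j ∈ s, u (P k * (C (e j) * P j)) = if k = j then e k * u (P k * P k) else 0 := by
    intro j _
    rw [mul_left_comm, map_C_mul]
    split_ifs with h
    · rw [h]
    · rw [(hu k j).1 h, mul_zero]
  rw [Finset.sum_congr rfl this]
  simp

theorem IsOrthogonal.mul_eq_zero {u : ℂ[X] →ₗ[ℂ] ℂ} {P : ℕ → ℂ[X]} (hu : IsOrthogonal u P)
    (hP : ∀ n, (P n).Monic ∧ (P n).natDegree = n) {n : ℕ} {f : ℂ[X]} (hf : f.degree < n) :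
    u (P n * f) = 0 := by
  obtain ⟨e, he⟩ := exists_eq_sum_of_degree_lt hP n f hf
  rw [he, hu.mul_sum]
  simp

theorem IsOrthogonal.mul_eq_coeff {u : ℂ[X] →ₗ[ℂ] ℂ} {P : ℕ → ℂ[X]} (hu : IsOrthogonal u P)
    (hP : ∀ n, (P n).Monic ∧ (P n).natDegree = n) {n : ℕ} {f : ℂ[X]} (hf : f.natDegree ≤ n) :
    u (P n * f) = f.coeff n * u (P n * P n) := by
  have hlt : (f - C (f.coeff n) * P n).degree < n := by
    rw [degree_lt_iff_coeff_zero]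
    intro m hm
    rw [coeff_sub, coeff_C_mul]
    rcases hm.eq_or_lt with rfl | hm
    · rw [coeff_self_eq_one hP]; ring
    · rw [coeff_eq_zero_of_natDegree_lt (by omega),
        coeff_eq_zero_of_natDegree_lt (p := P n) (by rw [(hP n).2]; exact hm)]
      ring
  have h := hu.mul_eq_zero hP hlt
  rw [mul_sub, map_sub, mul_left_comm, map_C_mul] at h
  exact sub_eq_zero.mp h

/-! ### Pearson equation, symmetry and self-coherence -/

/-- The Pearson equation for the functional `u`. -/
def IsPearson (q : ℂ) (d : QPair) (u : ℂ[X] →ₗ[ℂ] ℂ) : Prop :=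
  ∀ f, (q - 1) * u (d.polyA * qDeriv q f) = u (d.polyPsi * f)

/-- Summation by parts: the Pearson equation is applied to f · D_{1/q} h. The right side is
symmetric in f and h, hence so is u(f · Lh). -/
theorem IsPearson.mul_qHyp {q : ℂ} (hq0 : q ≠ 0) (hq : q ≠ 1) {d : QPair} {u : ℂ[X] →ₗ[ℂ] ℂ}
    (hu : IsPearson q d u) (f h : ℂ[X]) :
    u (f * qHyp q d h) = -((q - 1) ^ 2 * u (d.polyA * qDeriv q f * qDeriv q h)) := by
  have h1 := hu (f * qDeriv q⁻¹ h)
  rw [qDeriv_mul hq, qDeriv_inv_comp hq0 hq] at h1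
  have e1 : f * qHyp q d h = C ((q - 1) ^ 2) * (d.polyA * (f * qDeriv q (qDeriv q⁻¹ h)))
      - C (q - 1) * (d.polyPsi * (f * qDeriv q⁻¹ h)) := by
    rw [qHyp_apply]; ring
  have e2 : d.polyA * (f * qDeriv q (qDeriv q⁻¹ h) + qDeriv q h * qDeriv q f)
      = d.polyA * (f * qDeriv q (qDeriv q⁻¹ h)) + d.polyA * qDeriv q f * qDeriv q h := by ring
  rw [e2, map_add] at h1
  rw [e1, map_sub, map_C_mul, map_C_mul]
  linear_combination (q - 1) * h1

theorem qNumber_succ_ne_zero {q : ℂ} (hq : ∀ n : ℕ, 1 ≤ n → q ^ n ≠ 1) (n : ℕ) :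
    qNumber q (n + 1) ≠ 0 := by
  have hq1 : q ≠ 1 := by simpa using hq 1 le_rfl
  exact div_ne_zero (sub_ne_zero.mpr (hq _ (by omega))) (sub_ne_zero.mpr hq1)

theorem qDeriv_surjective {q : ℂ} (hq : ∀ n : ℕ, 1 ≤ n → q ^ n ≠ 1) :
    Function.Surjective (qDeriv q) := by
  intro g
  induction g using Polynomial.induction_on' with
  | add f g hf hg =>
    obtain ⟨a, rfl⟩ := hf
    obtain ⟨b, rfl⟩ := hg
    exact ⟨a + b, map_add _ _ _⟩
  | monomial n c =>
    refine ⟨monomial (n + 1) (c / qNumber q (n + 1)), ?_⟩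
    ext k
    rw [coeff_qDeriv, coeff_monomial, coeff_monomial]
    by_cases h : n = k
    · subst h
      have := qNumber_succ_ne_zero hq n
      simp only [if_true]
      field_simp
    · simp [h]

theorem natDegree_le_of_qDeriv {q : ℂ} (hq : ∀ n : ℕ, 1 ≤ n → q ^ n ≠ 1) (f : ℂ[X]) :
    f.natDegree ≤ (qDeriv q f).natDegree + 1 := by
  rw [natDegree_le_iff_coeff_eq_zero]
  intro m hm
  obtain ⟨k, rfl⟩ : ∃ k, m = k + 1 := ⟨m - 1, by omega⟩
  have h : (qDeriv q f).coeff k = 0 := coeff_eq_zero_of_natDegree_lt (by omega)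
  rw [coeff_qDeriv] at h
  exact (mul_eq_zero.mp h).resolve_left (qNumber_succ_ne_zero hq k)

theorem inv_pow_ne_one {q : ℂ} (hq : ∀ n : ℕ, 1 ≤ n → q ^ n ≠ 1) :
    ∀ n : ℕ, 1 ≤ n → q⁻¹ ^ n ≠ 1 := fun n hn => by
  rw [inv_pow]
  simpa using hq n hn

theorem natDegree_qDeriv_le (q : ℂ) (f : ℂ[X]) (n : ℕ) (hf : f.natDegree ≤ n + 1) :
    (qDeriv q f).natDegree ≤ n := by
  rw [natDegree_le_iff_coeff_eq_zero]
  intro k hk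
  rw [coeff_qDeriv, coeff_eq_zero_of_natDegree_lt (by omega), mul_zero]

theorem QPair.polyA_of_natDegree_le {π : ℂ[X]} (h : π.natDegree ≤ 2) (b1 b2 : ℂ) :
    (QPair.mk (π.coeff 0) (π.coeff 1) (π.coeff 2) b1 b2).polyA = π := by
  conv_rhs => rw [π.as_sum_range_C_mul_X_pow' (Nat.lt_succ_of_le h)]
  simp [QPair.polyA, Finset.sum_range_succ]

/-- A self-coherent orthogonal sequence consists of eigenpolynomials of an admissible `qHyp`. -/
theorem exists_eigen_of_selfCoherent {q : ℂ} (hq0 : q ≠ 0) (hq : ∀ n : ℕ, 1 ≤ n → q ^ n ≠ 1)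
    {P : ℕ → ℂ[X]} (hP : IsMonicOPS P) (h : SelfCoherent q 0 P) :
    ∃ d : QPair, d.polyA ≠ 0 ∧ d.Admissible q ∧
      ∀ n, qHyp q d (P n) = C (d.eig q n) * P n := by
  have hq1 : q ≠ 1 := by simpa using hq 1 le_rfl
  have h1 : q - 1 ≠ 0 := sub_ne_zero.mpr hq1
  obtain ⟨hP, u, hu⟩ := hP
  change IsOrthogonal u P at hu
  obtain ⟨N, hN, π, hπ, hπN, c, hc, hrel⟩ := h
  simp only [hahnD_zero_eq_qDeriv hq1] at hrel
  have hP0 : P 0 = 1 := (hP 0).1.natDegree_eq_zero.mp (hP 0).2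
  have hP1 : P 1 = X + C ((P 1).coeff 0) := by
    have := eq_X_add_C_of_natDegree_le_one (hP 1).2.le
    have e : (P 1).coeff 1 = 1 := coeff_self_eq_one hP 1
    rwa [e, C_1, one_mul] at this
  -- Testing the Pearson equation with (b - a)/x = (q-1)e P_1 against P_1 forces this value of e.
  obtain ⟨e, he⟩ : ∃ e, c 0 0 * u (P 0 * P 0) = e * u (P 1 * P 1) :=
    ⟨c 0 0 * u (P 0 * P 0) / u (P 1 * P 1), by have := (hu 1 1).2 rfl; field_simp⟩
  let d : QPair := ⟨π.coeff 0, π.coeff 1, π.coeff 2, π.coeff 1 + (q - 1) * e * (P 1).coeff 0,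
    π.coeff 2 + (q - 1) * e⟩
  have hA : d.polyA = π := QPair.polyA_of_natDegree_le (by omega) _ _
  have hPsi : d.polyPsi = C ((q - 1) * e) * P 1 := by
    rw [hP1]
    simp only [QPair.polyPsi, d, add_sub_cancel_left, C_mul]
    simp
    ring
  have hFk : ∀ n k, u (P k * (π * qDeriv q (P (n + 1))))
      = if k ∈ Finset.Icc n (n + N) then qNumber q (n + 1) * c n k * u (P k * P k) else 0 := by
    intro n k
    rw [hrel, mul_left_comm, map_C_mul, hu.mul_sum]
    split_ifs <;> ring
  -- It suffices to test on the P_m. For m = 0 both sides vanish; for m = 1 this is the choice of e;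
  -- for m ≥ 2 the structure relation contains only P_j with j ≥ 1, which u kills.
  have hpear : IsPearson q d u := by
    intro f
    rw [hA, hPsi]
    let v : ℂ[X] →ₗ[ℂ] ℂ := (q - 1) • (u ∘ₗ LinearMap.mulLeft ℂ π ∘ₗ qDeriv q)
      - u ∘ₗ LinearMap.mulLeft ℂ (C ((q - 1) * e) * P 1)
    have hv := functional_eq_zero hP v (fun n => ?_) f
    · simpa [v, sub_eq_zero, mul_assoc] using hv
    · simp only [v, LinearMap.sub_apply, LinearMap.smul_apply, LinearMap.comp_apply,
        LinearMap.mulLeft_apply, smul_eq_mul]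
      rw [mul_assoc (C _), map_C_mul]
      rcases n with _ | n
      · have : qDeriv q (P 0) = 0 := by
          ext k
          rw [coeff_qDeriv, hP0, coeff_one]
          simp
        rw [this, (hu 1 0).1 (by omega)]
        simp
      · have hF := hFk n 0
        rw [hP0, one_mul] at hF
        rw [hF]
        rcases n with _ | n
        · have : qNumber q (0 + 1) = 1 := by simp [qNumber, h1]
          rw [if_pos (by simp), this]
          rw [hP0] at he
          linear_combination (q - 1) * he
        · rw [if_neg (by simp), (hu 1 _).1 (by omega)]
          ring
  have heig : ∀ n, qHyp q d (P n) = C (d.eig q n) * P n := by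
    intro n
    have hlt : (qHyp q d (P n) - C (d.eig q n) * P n).degree < n := by
      rw [degree_lt_iff_coeff_zero]
      intro m hm
      have hc1 := coeff_natDegree_qHyp hq0 hq1 d (P n)
      rw [(hP n).2, (hP n).1.leadingCoeff] at hc1
      rw [coeff_sub, coeff_C_mul]
      rcases hm.eq_or_lt with rfl | hm
      · have : (P n).coeff n = 1 := coeff_self_eq_one hP n
        rw [hc1, this, sub_self]
      · have hd := natDegree_qHyp_le hq0 hq1 d (P n)
        rw [(hP n).2] at hd
        rw [coeff_eq_zero_of_natDegree_lt (by omega),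
          coeff_eq_zero_of_natDegree_lt (p := P n) (by rw [(hP n).2]; exact hm)]
        ring
    obtain ⟨w, hw⟩ := exists_eq_sum_of_degree_lt hP n _ hlt
    -- The P_k-component of L P_n vanishes for k < n: by symmetry it is governed by u(P_n · L P_k),
    -- and L P_k has degree at most k.
    have hw0 : ∀ k ∈ Finset.range n, C (w k) * P k = 0 := by
      intro k hk
      have hkn := Finset.mem_range.mp hk
      have h2 := congrArg (fun p => u (P k * p)) hw
      simp only [hu.mul_sum, if_pos hk, mul_sub, map_sub] at h2
      rw [mul_left_comm, map_C_mul, (hu k n).1 hkn.ne, hpear.mul_qHyp hq0 hq1] at h2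
      have h3 := hpear.mul_qHyp hq0 hq1 (P n) (P k)
      rw [hu.mul_eq_zero hP] at h3
      · have e : d.polyA * qDeriv q (P k) * qDeriv q (P n)
            = d.polyA * qDeriv q (P n) * qDeriv q (P k) := by ring
        rw [e, ← h3] at h2
        have h4 : w k = 0 := by
          have := (hu k k).2 rfl
          have h5 : w k * u (P k * P k) = 0 := by linear_combination -h2
          exact (mul_eq_zero.mp h5).resolve_right this
        rw [h4, C_0, zero_mul]
      · refine lt_of_le_of_lt degree_le_natDegree ?_
        have := natDegree_qHyp_le hq0 hq1 d (P k)
        rw [(hP k).2] at this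
        exact_mod_cast this.trans_lt hkn
    rw [Finset.sum_eq_zero hw0] at hw
    exact sub_eq_zero.mp hw
  refine ⟨d, by rw [hA]; exact hπ.ne_zero, ?_, heig⟩
  -- If a2 q^k = b2, the eigenvalue in degree k + 1 is zero, so symmetry gives u(π (D_q P_{k+1})²) =
  -- 0. But D_q P_{k+1} is [k+1]_q P_k plus lower terms, to which π D_q P_{k+1} is orthogonal, so
  -- the value is [k+1]_q² c_{k,k} u(P_k²) ≠ 0.
  intro k hk
  have h2 := hpear.mul_qHyp hq0 hq1 (P (k + 1)) (P (k + 1))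
  have h3 : d.eig q (k + 1) = 0 := by
    rw [QPair.eig, pow_succ, ← hk]
    have := pow_ne_zero k hq0
    field_simp
    ring
  rw [heig, h3, C_0, zero_mul, mul_zero, map_zero, hA] at h2
  have hdeg : (qDeriv q (P (k + 1)) - C (qNumber q (k + 1)) * P k).degree < k := by
    rw [degree_lt_iff_coeff_zero]
    intro m hm
    rw [coeff_sub, coeff_C_mul, coeff_qDeriv]
    rcases hm.eq_or_lt with rfl | hm
    · have e1 : (P (k + 1)).coeff (k + 1) = 1 := coeff_self_eq_one hP (k + 1)
      have e2 : (P k).coeff k = 1 := coeff_self_eq_one hP k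
      rw [e1, e2, sub_self]
    · rw [coeff_eq_zero_of_natDegree_lt (by rw [(hP (k + 1)).2]; omega),
        coeff_eq_zero_of_natDegree_lt (p := P k) (by rw [(hP k).2]; exact hm)]
      ring
  obtain ⟨w, hw⟩ := exists_eq_sum_of_degree_lt hP k _ hdeg
  have h4 : u (π * qDeriv q (P (k + 1)) * qDeriv q (P (k + 1)))
      = qNumber q (k + 1) * (qNumber q (k + 1) * c k k * u (P k * P k)) := by
    rw [sub_eq_iff_eq_add] at hw
    nth_rw 2 [hw]
    rw [mul_add, map_add, Finset.mul_sum, map_sum, Finset.sum_eq_zero, mul_left_comm, map_C_mul,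
      mul_comm _ (P k), hFk, if_pos (by simp)]
    · ring
    · intro j hj
      have := Finset.mem_range.mp hj
      rw [mul_left_comm, map_C_mul, mul_comm _ (P j), hFk, if_neg (by simp; omega), mul_zero]
  rw [h4] at h2
  have := qNumber_succ_ne_zero hq k
  have h5 : (q - 1) ^ 2 * (qNumber q (k + 1) * (qNumber q (k + 1) * c k k * u (P k * P k))) ≠ 0 :=
    mul_ne_zero (pow_ne_zero 2 h1) (mul_ne_zero this
      (mul_ne_zero (mul_ne_zero this (hc k).2) ((hu k k).2 rfl)))
  exact h5 (neg_eq_zero.mp h2.symm)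

/-- An orthogonal sequence of eigenpolynomials of an admissible `qHyp` is self-coherent. -/
theorem selfCoherent_of_eigen {q : ℂ} (hq0 : q ≠ 0) (hq : ∀ n : ℕ, 1 ≤ n → q ^ n ≠ 1)
    {P : ℕ → ℂ[X]} (hP : IsMonicOPS P) {d : QPair} (hA : d.polyA ≠ 0) (hd : d.Admissible q)
    (heig : ∀ n, qHyp q d (P n) = C (d.eig q n) * P n) : SelfCoherent q 0 P := by
  have hq1 : q ≠ 1 := by simpa using hq 1 le_rfl
  have h1 : q - 1 ≠ 0 := sub_ne_zero.mpr hq1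
  obtain ⟨hP, u, hu⟩ := hP
  change IsOrthogonal u P at hu
  have hP0 : P 0 = 1 := (hP 0).1.natDegree_eq_zero.mp (hP 0).2
  -- All L P_n are killed by u, hence so is the whole image of L. Since D_{1/q} is onto, this is the
  -- Pearson equation.
  have hpear : IsPearson q d u := by
    intro g
    obtain ⟨f, rfl⟩ := qDeriv_surjective (inv_pow_ne_one hq) g
    have h0 := functional_eq_zero hP (u ∘ₗ qHyp q d) (fun n => by
      rw [LinearMap.comp_apply, heig, map_C_mul]
      rcases n with _ | n
      · simp [QPair.eig]
      · have := (hu (n + 1) 0).1 (by omega)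
        rw [hP0, mul_one] at this
        rw [this, mul_zero]) f
    rw [LinearMap.comp_apply, qHyp_apply, map_sub, map_C_mul, map_C_mul] at h0
    apply mul_left_cancel₀ h1
    linear_combination h0
  set lc := d.polyA.leadingCoeff with hlc
  have hlc0 : lc ≠ 0 := leadingCoeff_ne_zero.mpr hA
  set N := d.polyA.natDegree with hN
  have hN2 : N ≤ 2 := by
    rw [hN, natDegree_le_iff_coeff_eq_zero]
    intro k hk
    rw [QPair.polyA, coeff_add, coeff_add, coeff_C_mul, coeff_C_mul, coeff_C, coeff_X, coeff_X_pow,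
      if_neg (by omega), if_neg (by omega), if_neg (by omega)]
    simp
  -- Writing P_k = D_q f and using symmetry reduces the pairing to u(f P_{n+1}), which sees only the
  -- X^(n+1) coefficient of f. It vanishes for k < n and not for k = n, which gives both the lower
  -- end of the sum and c_{n,n} ≠ 0.
  have hPD : ∀ n k, k ≤ n → (q - 1) ^ 2 * u (P k * (d.polyA * qDeriv q (P (n + 1))))
      = -(d.eig q (n + 1) * ((P k).coeff n / qNumber q (n + 1) * u (P (n + 1) * P (n + 1)))) := by
    intro n k hk
    obtain ⟨f, hf⟩ := qDeriv_surjective hq (P k)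
    have hfd := natDegree_le_of_qDeriv hq f
    rw [hf, (hP k).2] at hfd
    have hfc : f.coeff (n + 1) = (P k).coeff n / qNumber q (n + 1) := by
      rw [← hf, coeff_qDeriv]
      have := qNumber_succ_ne_zero hq n
      field_simp
    have h2 := hpear.mul_qHyp hq0 hq1 f (P (n + 1))
    rw [heig, mul_left_comm, map_C_mul, mul_comm f, hu.mul_eq_coeff hP (by omega), hfc, hf] at h2
    rw [h2, neg_neg]
    congr 2
    ring
  have hexp : ∀ n, ∃ e : ℕ → ℂ, d.polyA * qDeriv q (P (n + 1))
      = ∑ j ∈ Finset.range (n + N + 1), C (e j) * P j := by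
    intro n
    apply exists_eq_sum_of_degree_lt hP
    have e1 := natDegree_qDeriv_le q (P (n + 1)) n (hP (n + 1)).2.le
    have e2 := natDegree_mul_le (p := d.polyA) (q := qDeriv q (P (n + 1)))
    exact lt_of_le_of_lt degree_le_natDegree (by exact_mod_cast (by omega))
  choose e he using hexp
  have he0 : ∀ n k, k < n → e n k = 0 := by
    intro n k hk
    have h2 := hPD n k hk.le
    rw [he, hu.mul_sum, if_pos (by simp; omega),
      coeff_eq_zero_of_natDegree_lt (by rw [(hP k).2]; exact hk)] at h2
    simpa [h1, (hu k k).2 rfl] using h2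
  have hen : ∀ n, e n n ≠ 0 := by
    intro n h0
    have h2 := hPD n n le_rfl
    rw [he, hu.mul_sum, if_pos (by simp), h0, coeff_self_eq_one hP] at h2
    have h3 := qNumber_succ_ne_zero hq n
    have h4 := (hu (n + 1) (n + 1)).2 rfl
    have h5 : d.eig q (n + 1) ≠ 0 := by
      intro h
      have : d.eig q (n + 1) = d.eig q 0 := by rw [h]; simp [QPair.eig]
      exact absurd (QPair.eig_injective hq0 hq hd this) (by omega)
    simp [h3, h4, h5] at h2
  have heN : ∀ n, e n (n + N) = lc * qNumber q (n + 1) := by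
    intro n
    have h2 := congrArg (fun p => p.coeff (N + n)) (he n)
    have e1 := natDegree_qDeriv_le q (P (n + 1)) n (hP (n + 1)).2.le
    simp only [coeff_mul_add_eq_of_natDegree_le hN.ge e1, coeff_qDeriv] at h2
    rw [coeff_self_eq_one hP, add_comm N n, finsetSum_coeff, Finset.sum_range_succ,
      Finset.sum_eq_zero, coeff_C_mul, coeff_self_eq_one hP] at h2
    · rw [hlc, leadingCoeff]
      linear_combination -h2
    · intro j hj
      rw [coeff_C_mul, coeff_eq_zero_of_natDegree_lt, mul_zero]
      rw [(hP j).2]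
      exact Finset.mem_range.mp hj
  refine ⟨N, hN2, C lc⁻¹ * d.polyA, ?_, ?_, fun n j => e n j / (lc * qNumber q (n + 1)), ?_, ?_⟩
  · rw [mul_comm]
    exact monic_mul_leadingCoeff_inv hA
  · rw [natDegree_C_mul (inv_ne_zero hlc0)]
  · intro n
    have h3 := qNumber_succ_ne_zero hq n
    exact ⟨by simp only [heN]; field_simp, div_ne_zero (hen n) (mul_ne_zero hlc0 h3)⟩
  · intro n
    have h3 := qNumber_succ_ne_zero hq n
    have hsub : Finset.Icc n (n + N) ⊆ Finset.range (n + N + 1) := by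
      intro j hj
      rw [Finset.mem_Icc] at hj
      rw [Finset.mem_range]
      omega
    rw [hahnD_zero_eq_qDeriv hq1, mul_assoc, he, ← Finset.sum_subset hsub, Finset.mul_sum,
      Finset.mul_sum]
    · refine Finset.sum_congr rfl fun j _ => ?_
      rw [← mul_assoc, ← mul_assoc, ← C_mul, ← C_mul]
      congr 2
      beta_reduce
      field_simp
    · intro j hj hj'
      simp at hj hj'
      rw [he0 n j (by omega), C_0, zero_mul]

/-! ### Affine changes of variable and inversion of the base -/

theorem hahnD_comp {q : ℂ} (hq : q ≠ 1) {ω ω' s : ℂ} (hs : q * s + ω = s + ω') (f : ℂ[X]) :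
    (hahnD q ω f).comp (X + C s) = hahnD q ω' (f.comp (X + C s)) := by
  have h1 : q - 1 ≠ 0 := sub_ne_zero.mpr hq
  have h0 : (C (q - 1) * X + C ω' : ℂ[X]) ≠ 0 := by
    intro h
    have := congrArg (fun p : ℂ[X] => p.coeff 1) h
    simp [coeff_C] at this
    exact h1 this
  refine mul_left_cancel₀ h0 ?_
  rw [hahnD_mul q ω' hq]
  have h := congrArg (fun p => p.comp (X + C s)) (hahnD_mul q ω hq f)
  have hsC : C q * C s + C ω = (C s + C ω' : ℂ[X]) := by rw [← C_mul, ← C_add, hs, C_add]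
  have e1 : (C (q - 1) * X + C ω : ℂ[X]).comp (X + C s) = C (q - 1) * X + C ω' := by
    simp only [add_comp, mul_comp, C_comp, X_comp]
    rw [C_sub, C_1]
    linear_combination hsC
  have e2 : (C q * X + C ω : ℂ[X]).comp (X + C s) = (X + C s).comp (C q * X + C ω') := by
    simp only [add_comp, mul_comp, C_comp, X_comp]
    linear_combination hsC
  simp only [mul_comp, sub_comp, comp_assoc, e1, e2] at h
  rw [h, comp_assoc]

theorem SelfCoherent.comp_X_add_C {q : ℂ} (hq : q ≠ 1) {ω ω' s : ℂ} (hs : q * s + ω = s + ω')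
    {P : ℕ → ℂ[X]} (h : SelfCoherent q ω P) :
    SelfCoherent q ω' (fun n => (P n).comp (X + C s)) := by
  obtain ⟨N, hN, π, hπ, hπN, c, hc, hrel⟩ := h
  refine ⟨N, hN, π.comp (X + C s), hπ.comp_X_add_C s, ?_, c, hc, fun n => ?_⟩
  · rw [natDegree_comp, natDegree_X_add_C, mul_one, hπN]
  · rw [← hahnD_comp hq hs, ← mul_comp, hrel]
    simp [Polynomial.sum_comp]

theorem selfCoherent_iff_comp {q : ℂ} (hq : q ≠ 1) (ω : ℂ) (P : ℕ → ℂ[X]) :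
    SelfCoherent q ω P ↔ SelfCoherent q 0 (fun n => (P n).comp (X + C (ω / (1 - q)))) := by
  have h1 : 1 - q ≠ 0 := sub_ne_zero.mpr hq.symm
  constructor
  · exact fun h => h.comp_X_add_C hq (by field_simp; ring)
  · intro h
    have h2 := h.comp_X_add_C hq (s := -(ω / (1 - q))) (ω' := ω) (by field_simp; ring)
    have e : ∀ n, ((P n).comp (X + C (ω / (1 - q)))).comp (X + C (-(ω / (1 - q)))) = P n := by
      intro n
      simp [comp_assoc]
    simpa only [e] using h2

/-- The functional is carried along by the inverse translation. -/
theorem IsMonicOPS.comp_X_add_C {P : ℕ → ℂ[X]} (hP : IsMonicOPS P) (s : ℂ) :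
    IsMonicOPS (fun n => (P n).comp (X + C s)) := by
  obtain ⟨hP, u, hu⟩ := hP
  refine ⟨fun n => ⟨(hP n).1.comp_X_add_C s, ?_⟩,
    u ∘ₗ (Polynomial.aeval (X - C s : ℂ[X])).toLinearMap, fun n m => ?_⟩
  · rw [natDegree_comp, natDegree_X_add_C, mul_one, (hP n).2]
  · have e : ∀ n, ((P n).comp (X + C s)).comp (X - C s) = P n := fun n => by
      simp [comp_assoc]
    have e2 : aeval (X - C s : ℂ[X]) ((P n).comp (X + C s) * (P m).comp (X + C s))
        = P n * P m := by
      rw [← comp_eq_aeval, mul_comp, e, e]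
    rw [LinearMap.comp_apply, AlgHom.toLinearMap_apply, e2]
    exact hu n m

theorem affineSeq_comp_X_add_C (r s : ℂ) (R : ℕ → ℂ[X]) (n : ℕ) :
    (affineSeq r s R n).comp (X + C s) = affineSeq r 0 R n := by
  simp [affineSeq, comp_assoc]

theorem eq_affineSeq_iff (r s : ℂ) (P R : ℕ → ℂ[X]) :
    P = affineSeq r s R ↔ (fun n => (P n).comp (X + C s)) = affineSeq r 0 R := by
  constructor
  · rintro rfl
    exact funext fun n => affineSeq_comp_X_add_C r s R n
  · intro h
    funext n
    have h1 := congrArg (fun p => p.comp (X - C s)) ((congrFun h n).trans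
      (affineSeq_comp_X_add_C r s R n).symm)
    simpa [comp_assoc] using h1

theorem coeff_affineSeq (r : ℂ) (R : ℕ → ℂ[X]) (n k : ℕ) :
    (affineSeq r 0 R n).coeff k = r ^ n * ((R n).coeff k * r⁻¹ ^ k) := by
  rw [affineSeq, C_0, sub_zero, coeff_C_mul, comp_C_mul_X_coeff]

theorem affineSeq_monic {r : ℂ} (hr : r ≠ 0) {R : ℕ → ℂ[X]}
    (hR : ∀ n, (R n).Monic ∧ (R n).natDegree = n) (n : ℕ) :
    (affineSeq r 0 R n).Monic ∧ (affineSeq r 0 R n).natDegree = n := by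
  have h1 : (affineSeq r 0 R n).coeff n = 1 := by
    rw [coeff_affineSeq, coeff_self_eq_one hR, inv_pow, one_mul]
    exact mul_inv_cancel₀ (pow_ne_zero n hr)
  have h2 : (affineSeq r 0 R n).natDegree ≤ n := by
    rw [natDegree_le_iff_coeff_eq_zero]
    intro k hk
    rw [coeff_affineSeq, coeff_eq_zero_of_natDegree_lt (by rw [(hR n).2]; exact hk)]
    ring
  exact ⟨monic_of_natDegree_le_of_coeff_eq_one n h2 h1,
    natDegree_eq_of_le_of_coeff_ne_zero h2 (by rw [h1]; exact one_ne_zero)⟩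

/-- The effect of the change of variable `x ↦ x / r` and of multiplication by `t` on a pair. -/
def QPair.scale (t r : ℂ) (d : QPair) : QPair :=
  ⟨t * r ^ 2 * d.a0, t * r * d.a1, t * d.a2, t * r * d.b1, t * d.b2⟩

theorem QPair.Admissible.scale {q : ℂ} {t : ℂ} (ht : t ≠ 0) (r : ℂ) {d : QPair}
    (hd : d.Admissible q) : (d.scale t r).Admissible q := by
  intro k h
  refine hd k (mul_left_cancel₀ ht ?_)
  simp only [QPair.scale] at h
  linear_combination h

theorem QPair.Admissible.of_scale {q : ℂ} {t r : ℂ} {d : QPair}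
    (hd : (d.scale t r).Admissible q) : d.Admissible q := by
  intro k h
  apply hd k
  simp only [QPair.scale]
  rw [← h]
  ring

/-- Scaling multiplies `eig`, `eig₁`, `eig₂` by t, tr, tr²; these powers of r match the weights on
the coefficients of the rescaled polynomials. -/
theorem qHyp_affineSeq {q : ℂ} (hq0 : q ≠ 0) (hq : q ≠ 1) {d : QPair} {t r : ℂ} (hr : r ≠ 0)
    {R : ℕ → ℂ[X]} (h : ∀ n, qHyp q d (R n) = C (d.eig q n) * R n) (n : ℕ) :
    qHyp q (d.scale t r) (affineSeq r 0 R n)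
      = C ((d.scale t r).eig q n) * affineSeq r 0 R n := by
  ext k
  have h1 := congrArg (fun p => p.coeff k) (h n)
  simp only [coeff_qHyp hq0 hq, coeff_C_mul] at h1
  simp only [coeff_qHyp hq0 hq, coeff_C_mul, coeff_affineSeq]
  have e1 : (d.scale t r).eig q = fun n => t * d.eig q n := by
    funext n; simp only [QPair.eig, QPair.scale]; ring
  have e2 : (d.scale t r).eig₁ q = fun n => t * r * d.eig₁ q n := by
    funext n; simp only [QPair.eig₁, QPair.scale]; ring
  have e3 : (d.scale t r).eig₂ q = fun n => t * r ^ 2 * d.eig₂ q n := by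
    funext n; simp only [QPair.eig₂, QPair.scale]; ring
  simp only [e1, e2, e3, pow_succ]
  field_simp
  linear_combination t * h1

/-- Interchange of the two polynomials of a pair. -/
def QPair.swap (d : QPair) : QPair := ⟨d.a0, d.b1, d.b2, d.a1, d.a2⟩

theorem QPair.Admissible.swap {q : ℂ} (hq0 : q ≠ 0) {d : QPair} (hd : d.Admissible q) :
    d.swap.Admissible q⁻¹ := by
  intro k h
  apply hd k
  simp only [QPair.swap] at h
  rw [← h, inv_pow, mul_assoc, inv_mul_cancel₀ (pow_ne_zero k hq0), mul_one]

/-- Exchanging a with b and q with 1/q only multiplies L by 1/q. -/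
theorem qHyp_swap {q : ℂ} (hq0 : q ≠ 0) (hq : q ≠ 1) {d : QPair} {f : ℂ[X]} {n : ℕ}
    (h : qHyp q d f = C (d.eig q n) * f) :
    qHyp q⁻¹ d.swap f = C (d.swap.eig q⁻¹ n) * f := by
  have hqi : q⁻¹ ≠ 1 := by simpa using hq
  ext k
  have h1 := congrArg (fun p => p.coeff k) h
  simp only [coeff_qHyp hq0 hq, coeff_C_mul] at h1
  simp only [coeff_qHyp (inv_ne_zero hq0) hqi, coeff_C_mul]
  have e1 : d.swap.eig q⁻¹ = fun n => q⁻¹ * d.eig q n := by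
    funext n
    have := pow_ne_zero n hq0
    simp only [QPair.eig, QPair.swap, inv_pow]
    field_simp
    ring
  have e2 : d.swap.eig₁ q⁻¹ = fun n => q⁻¹ * d.eig₁ q n := by
    funext n
    have := pow_ne_zero n hq0
    simp only [QPair.eig₁, QPair.swap, inv_pow]
    field_simp
    ring
  have e3 : d.swap.eig₂ q⁻¹ = fun n => q⁻¹ * d.eig₂ q n := by
    funext n
    have := pow_ne_zero n hq0
    simp only [QPair.eig₂, QPair.swap, inv_pow]
    field_simp
    ring
  simp only [e1, e2, e3]
  linear_combination q⁻¹ * h1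

/-- If the coefficient vanished, pairing the recurrence for P_{n+2} with P_n would give u(P_{n+1} ·
xP_n) = 0. But xP_n is P_{n+1} plus lower terms, so this value is u(P_{n+1}²). -/
theorem IsMonicOPS.gamma_ne_zero {β γ : ℕ → ℂ} (h : IsMonicOPS (ttrrSeq β γ)) (n : ℕ) :
    γ n ≠ 0 := by
  intro h0
  obtain ⟨hP, u, hu⟩ := h
  have h1 : ttrrSeq β γ (n + 2) = (X - C (β (n + 1))) * ttrrSeq β γ (n + 1) := by
    rw [ttrrSeq, h0, C_0, zero_mul, sub_zero]
  have e1 : u (ttrrSeq β γ (n + 1) * (X * ttrrSeq β γ n)) = 0 := by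
    have h2 := (hu (n + 2) n).1 (by omega)
    rw [h1, sub_mul, sub_mul, map_sub, mul_assoc (C _), map_C_mul, (hu (n + 1) n).1 (by omega),
      mul_zero, sub_zero] at h2
    rw [← h2]
    congr 1
    ring
  have h3 := IsOrthogonal.mul_eq_coeff (u := u) hu hP (n := n + 1) (f := X * ttrrSeq β γ n) (by
    rw [natDegree_X_mul (hP n).1.ne_zero, (hP n).2])
  rw [e1, coeff_X_mul, coeff_self_eq_one hP, one_mul] at h3
  exact (hu (n + 1) (n + 1)).2 rfl h3.symm

/-! ### The rows of the table as eigenpolynomials -/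

/-- The data of the big `q`-Jacobi polynomials. -/
def bigQJacobiPair (q a b c : ℂ) : QPair := ⟨a * c * q, -a * q * (b + c), a * b * q, -(a + c), q⁻¹⟩

/-- The pair factors as aq(x - 1)(bx - c) and (x - aq)(x - cq)/q. The denominator D is a free symbol
so that clearing denominators does not expand it. -/
theorem bigQJacobiPair_sub₁ {q : ℂ} (hq0 : q ≠ 0) (h1 : q - 1 ≠ 0) {a b c z D : ℂ}
    (hD : D = 1 - a * b * z ^ 2) (h : D ≠ 0) : (bigQJacobiPair q a b c).sub₁ q z
      = -(q * (z - 1) * ((a + c) - a * (b + c) * z)) / ((q - 1) * D) := by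
  have e : a * b * q * z ^ 2 - q⁻¹ * q ^ 2 = -q * D := by
    rw [hD]
    field_simp
    ring
  simp only [QPair.sub₁, bigQJacobiPair]
  rw [e]
  field_simp
  ring

theorem bigQJacobiPair_sub₂ {q : ℂ} (hq0 : q ≠ 0) (h1 : q - 1 ≠ 0) (h2 : q + 1 ≠ 0)
    {a b c z D D' : ℂ} (hD : D = 1 - a * b * z ^ 2) (h : D ≠ 0)
    (hD' : q * D' = q - a * b * z ^ 2) (h' : D' ≠ 0) :
    (bigQJacobiPair q a b c).sub₂ q z
      = q * (z - q) * (z - 1) * (((a + c) * q - a * (b + c) * z) * ((a + c) - a * (b + c) * z)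
        - a * c * (q - 1) * D) / ((q + 1) * (q - 1) ^ 2 * D * D') := by
  have e : a * b * q * z ^ 2 - q⁻¹ * q ^ 3 = -q ^ 2 * D' := by
    have : -q ^ 2 * D' = -q * (q * D') := by ring
    rw [this, hD']
    field_simp
    ring
  have e2 : q ^ 2 - 1 = (q + 1) * (q - 1) := by ring
  rw [QPair.sub₂, bigQJacobiPair_sub₁ hq0 h1 hD h]
  simp only [bigQJacobiPair]
  rw [e, e2]
  field_simp
  ring

theorem bigQJacobi_gamma_aux {q a b c z D1 D2 D3 D4 : ℂ} (hq0 : q ≠ 0) (h1 : q - 1 ≠ 0)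
    (h2 : q + 1 ≠ 0) (hc : c ≠ 0)
    (e1 : D1 = 1 - a * b * q * z ^ 2) (e2 : D2 = 1 - a * b * q ^ 2 * z ^ 2)
    (e3 : D3 = 1 - a * b * q ^ 3 * z ^ 2) (e4 : D4 = 1 - a * b * q ^ 4 * z ^ 2)
    (n1 : D1 ≠ 0) (n2 : D2 ≠ 0) (n3 : D3 ≠ 0) (n4 : D4 ≠ 0) :
    (bigQJacobiPair q a b c).sub₂ q (z * q) - (bigQJacobiPair q a b c).sub₂ q (z * q * q)
      - ((bigQJacobiPair q a b c).sub₁ q (z * q) - (bigQJacobiPair q a b c).sub₁ q (z * q * q))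
        * (bigQJacobiPair q a b c).sub₁ q (z * q)
      = (1 - a * b * z * q) / D1 * ((1 - a * z * q) * (1 - c * z * q)) / D2
        * (-a * c * (z * q * q) * (1 - z * q) * (1 - a * b * c⁻¹ * (z * q)) * (1 - b * (z * q))
          / (D2 * D3)) := by
  rw [bigQJacobiPair_sub₁ hq0 h1 (D := D2) (by rw [e2]; ring) n2,
    bigQJacobiPair_sub₁ hq0 h1 (D := D4) (by rw [e4]; ring) n4,
    bigQJacobiPair_sub₂ hq0 h1 h2 (D := D2) (D' := D1) (by rw [e2]; ring) n2 (by rw [e1]; ring) n1,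
    bigQJacobiPair_sub₂ hq0 h1 h2 (D := D4) (D' := D3) (by rw [e4]; ring) n4 (by rw [e3]; ring) n3]
  field_simp
  rw [e1, e2, e3, e4]
  ring

/-- The numerator vanishes. Admissibility does not cover the denominator here; if it is zero too,
the quotient is 0 by convention. The same holds for `sub₂` at z = q. -/
theorem QPair.sub₁_one (q : ℂ) (d : QPair) : d.sub₁ q 1 = 0 := by simp [QPair.sub₁]

theorem QPair.sub₂_self (q : ℂ) (d : QPair) : d.sub₂ q q = 0 := by simp [QPair.sub₂]

/-- Comparison of a three-term recurrence with the recurrence of the eigenpolynomials. -/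
theorem QPair.ttrrSeq_eq {q : ℂ} {d : QPair} {β γ : ℕ → ℂ}
    (hβ0 : -d.sub₁ q q = β 0)
    (hγ0 : -d.sub₂ q (q * q) - (d.sub₁ q q - d.sub₁ q (q * q)) * d.sub₁ q q = γ 0)
    (hβ : ∀ n, d.sub₁ q (q ^ (n + 1)) - d.sub₁ q (q ^ (n + 1) * q) = β (n + 1))
    (hγ : ∀ n, d.sub₂ q (q ^ (n + 1) * q) - d.sub₂ q (q ^ (n + 1) * q * q)
      - (d.sub₁ q (q ^ (n + 1) * q) - d.sub₁ q (q ^ (n + 1) * q * q)) * d.sub₁ q (q ^ (n + 1) * q)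
      = γ (n + 1)) : ttrrSeq β γ = ttrrSeq (d.beta q) (d.gamma q) := by
  congr 1
  · funext n
    rcases n with _ | n
    · rw [← hβ0, QPair.beta]
      simp [QPair.sub₁_one]
    · rw [← hβ, QPair.beta, pow_succ q (n + 1)]
  · funext n
    rcases n with _ | n
    · rw [← hγ0, QPair.gamma, QPair.beta]
      simp only [zero_add, one_add_one_eq_two, pow_one, pow_two, QPair.sub₂_self]
      ring
    · rw [← hγ, QPair.gamma, QPair.beta]
      simp only [pow_succ]

/-- The condition on ab is exactly admissibility. The remaining exclusions of the table concern the
nonvanishing of γ and play no part here. -/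
theorem bigQJacobi_eq {q : ℂ} (hq0 : q ≠ 0) (hq : ∀ n : ℕ, 1 ≤ n → q ^ n ≠ 1) {a b c : ℂ}
    (hc : c ≠ 0) (h : ∀ k, 1 - a * b * q ^ (k + 2) ≠ 0) :
    bigQJacobi q a b c
      = ttrrSeq ((bigQJacobiPair q a b c).beta q) ((bigQJacobiPair q a b c).gamma q) := by
  have h1 : q - 1 ≠ 0 := sub_ne_zero.mpr (by simpa using hq 1 le_rfl)
  have h2 : q + 1 ≠ 0 := fun e => hq 2 (by omega) (by linear_combination (q - 1) * e)
  refine QPair.ttrrSeq_eq ?_ ?_ (fun n => ?_) (fun n => ?_)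
  · have n2 := h 0
    obtain ⟨D2, e2⟩ : ∃ D, D = 1 - a * b * q ^ (0 + 2) := ⟨_, rfl⟩
    rw [← e2] at n2
    rw [bigQJacobiPair_sub₁ hq0 h1 (D := D2) (by rw [e2]) n2]
    simp only [bigQJacobiA, bigQJacobiC, jacobiFactor, if_true, mul_zero, ← e2]
    field_simp
    rw [e2]
    ring
  · have n2 := h 0
    have n3 := h 1
    have n4 := h 2
    obtain ⟨D2, e2⟩ : ∃ D, D = 1 - a * b * q ^ (0 + 2) := ⟨_, rfl⟩
    obtain ⟨D3, e3⟩ : ∃ D, D = 1 - a * b * q ^ (1 + 2) := ⟨_, rfl⟩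
    obtain ⟨D4, e4⟩ : ∃ D, D = 1 - a * b * q ^ (2 + 2) := ⟨_, rfl⟩
    rw [← e2] at n2
    rw [← e3] at n3
    rw [← e4] at n4
    rw [bigQJacobiPair_sub₁ hq0 h1 (D := D2) (by rw [e2]) n2,
      bigQJacobiPair_sub₁ hq0 h1 (D := D4) (by rw [e4]; ring) n4,
      bigQJacobiPair_sub₂ hq0 h1 h2 (D := D4) (D' := D3) (by rw [e4]; ring) n4
        (by rw [e3]; ring) n3]
    have e2' : 1 - a * b * q ^ (2 * (0 + 1)) = D2 := e2.symm
    have e3' : 1 - a * b * q ^ (2 * (0 + 1) + 1) = D3 := e3.symm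
    simp only [bigQJacobiA, bigQJacobiC, jacobiFactor, if_true, Nat.succ_ne_zero, if_false, mul_zero,
      e2', e3']
    field_simp
    rw [e2, e3, e4]
    ring
  · have n0 := h (2 * n)
    have n1 := h (2 * n + 1)
    have n2 := h (2 * n + 2)
    obtain ⟨D0, e0⟩ : ∃ D, D = 1 - a * b * q ^ (2 * n + 2) := ⟨_, rfl⟩
    obtain ⟨D1, e1⟩ : ∃ D, D = 1 - a * b * q ^ (2 * n + 1 + 2) := ⟨_, rfl⟩
    obtain ⟨D2, e2⟩ : ∃ D, D = 1 - a * b * q ^ (2 * n + 2 + 2) := ⟨_, rfl⟩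
    rw [← e0] at n0
    rw [← e1] at n1
    rw [← e2] at n2
    rw [bigQJacobiPair_sub₁ hq0 h1 (D := D0) (by rw [e0]; ring) n0,
      bigQJacobiPair_sub₁ hq0 h1 (D := D2) (by rw [e2]; ring) n2]
    have e0' : 1 - a * b * q ^ (2 * (n + 1)) = D0 := e0.symm
    have e1' : 1 - a * b * q ^ (2 * (n + 1) + 1) = D1 := e1.symm
    have e2' : 1 - a * b * q ^ (2 * (n + 1) + 2) = D2 := e2.symm
    simp only [bigQJacobiA, bigQJacobiC, jacobiFactor, Nat.succ_ne_zero, if_false, e0', e1', e2',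
      pow_succ q (n + 1)]
    have f0 : D0 = 1 - a * b * (q ^ (n + 1)) ^ 2 := by rw [e0]; ring
    have f1 : D1 = 1 - a * b * (q ^ (n + 1)) ^ 2 * q := by rw [e1]; ring
    have f2 : D2 = 1 - a * b * (q ^ (n + 1)) ^ 2 * q ^ 2 := by rw [e2]; ring
    clear e0 e1 e2 e0' e1' e2'
    generalize q ^ (n + 1) = z at *
    field_simp
    rw [f0, f1, f2]
    ring
  · have n1 := h (2 * n + 1)
    have n2 := h (2 * n + 2)
    have n3 := h (2 * n + 3)
    have n4 := h (2 * n + 4)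
    rw [bigQJacobi_gamma_aux hq0 h1 h2 hc (by ring) (by ring) (by ring) (by ring) n1 n2 n3 n4]
    simp only [bigQJacobiA, bigQJacobiC, jacobiFactor, Nat.succ_ne_zero, if_false]
    ring_nf

/-- The data of the little `q`-Jacobi polynomials. -/
def littleQJacobiPair (q a b : ℂ) : QPair := ⟨0, -a, a * b * q, -q⁻¹, q⁻¹⟩

/-- The pair factors as ax(bqx - 1) and x(x - 1)/q. -/
theorem littleQJacobiPair_sub₁ {q : ℂ} (hq0 : q ≠ 0) (h1 : q - 1 ≠ 0) {a b z D : ℂ}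
    (hD : D = 1 - a * b * z ^ 2) (h : D ≠ 0) : (littleQJacobiPair q a b).sub₁ q z
      = -((z - 1) * (1 - a * z)) / ((q - 1) * D) := by
  have e : a * b * q * z ^ 2 - q⁻¹ * q ^ 2 = -q * D := by
    rw [hD]
    field_simp
    ring
  simp only [QPair.sub₁, littleQJacobiPair]
  rw [e]
  field_simp
  ring

theorem littleQJacobiPair_sub₂ {q : ℂ} (hq0 : q ≠ 0) (h1 : q - 1 ≠ 0) (h2 : q + 1 ≠ 0)
    {a b z D D' : ℂ} (hD : D = 1 - a * b * z ^ 2) (h : D ≠ 0)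
    (hD' : q * D' = q - a * b * z ^ 2) (h' : D' ≠ 0) :
    (littleQJacobiPair q a b).sub₂ q z
      = (z - q) * (z - 1) * (q - a * z) * (1 - a * z) / (q * (q + 1) * (q - 1) ^ 2 * D * D') := by
  have e : a * b * q * z ^ 2 - q⁻¹ * q ^ 3 = -q ^ 2 * D' := by
    have : -q ^ 2 * D' = -q * (q * D') := by ring
    rw [this, hD']
    field_simp
    ring
  have e2 : q ^ 2 - 1 = (q + 1) * (q - 1) := by ring
  rw [QPair.sub₂, littleQJacobiPair_sub₁ hq0 h1 hD h]
  simp only [littleQJacobiPair]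
  rw [e, e2]
  field_simp
  ring

theorem littleQJacobi_eq {q : ℂ} (hq0 : q ≠ 0) (hq : ∀ n : ℕ, 1 ≤ n → q ^ n ≠ 1) {a b : ℂ}
    (h : ∀ k, 1 - a * b * q ^ (k + 2) ≠ 0) :
    littleQJacobi q a b
      = ttrrSeq ((littleQJacobiPair q a b).beta q) ((littleQJacobiPair q a b).gamma q) := by
  have h1 : q - 1 ≠ 0 := sub_ne_zero.mpr (by simpa using hq 1 le_rfl)
  have h2 : q + 1 ≠ 0 := fun e => hq 2 (by omega) (by linear_combination (q - 1) * e)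
  refine QPair.ttrrSeq_eq ?_ ?_ (fun n => ?_) (fun n => ?_)
  · have n2 := h 0
    obtain ⟨D2, e2⟩ : ∃ D, D = 1 - a * b * q ^ (0 + 2) := ⟨_, rfl⟩
    rw [← e2] at n2
    rw [littleQJacobiPair_sub₁ hq0 h1 (D := D2) (by rw [e2]) n2]
    simp only [littleQJacobiA, littleQJacobiC, jacobiFactor, if_true, mul_zero, ← e2]
    field_simp
    ring
  · have n2 := h 0
    have n3 := h 1
    have n4 := h 2
    obtain ⟨D2, e2⟩ : ∃ D, D = 1 - a * b * q ^ (0 + 2) := ⟨_, rfl⟩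
    obtain ⟨D3, e3⟩ : ∃ D, D = 1 - a * b * q ^ (1 + 2) := ⟨_, rfl⟩
    obtain ⟨D4, e4⟩ : ∃ D, D = 1 - a * b * q ^ (2 + 2) := ⟨_, rfl⟩
    rw [← e2] at n2
    rw [← e3] at n3
    rw [← e4] at n4
    rw [littleQJacobiPair_sub₁ hq0 h1 (D := D2) (by rw [e2]) n2,
      littleQJacobiPair_sub₁ hq0 h1 (D := D4) (by rw [e4]; ring) n4,
      littleQJacobiPair_sub₂ hq0 h1 h2 (D := D4) (D' := D3) (by rw [e4]; ring) n4
        (by rw [e3]; ring) n3]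
    have e2' : 1 - a * b * q ^ (2 * (0 + 1)) = D2 := e2.symm
    have e3' : 1 - a * b * q ^ (2 * (0 + 1) + 1) = D3 := e3.symm
    simp only [littleQJacobiA, littleQJacobiC, jacobiFactor, if_true, Nat.succ_ne_zero, if_false,
      e2', e3']
    field_simp
    rw [e2, e3, e4]
    ring
  · have n0 := h (2 * n)
    have n1 := h (2 * n + 1)
    have n2 := h (2 * n + 2)
    obtain ⟨D0, e0⟩ : ∃ D, D = 1 - a * b * q ^ (2 * n + 2) := ⟨_, rfl⟩
    obtain ⟨D1, e1⟩ : ∃ D, D = 1 - a * b * q ^ (2 * n + 1 + 2) := ⟨_, rfl⟩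
    obtain ⟨D2, e2⟩ : ∃ D, D = 1 - a * b * q ^ (2 * n + 2 + 2) := ⟨_, rfl⟩
    rw [← e0] at n0
    rw [← e1] at n1
    rw [← e2] at n2
    rw [littleQJacobiPair_sub₁ hq0 h1 (D := D0) (by rw [e0]; ring) n0,
      littleQJacobiPair_sub₁ hq0 h1 (D := D2) (by rw [e2]; ring) n2]
    have e0' : 1 - a * b * q ^ (2 * (n + 1)) = D0 := e0.symm
    have e1' : 1 - a * b * q ^ (2 * (n + 1) + 1) = D1 := e1.symm
    have e2' : 1 - a * b * q ^ (2 * (n + 1) + 2) = D2 := e2.symm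
    simp only [littleQJacobiA, littleQJacobiC, jacobiFactor, Nat.succ_ne_zero, if_false, e0', e1',
      e2', pow_succ q (n + 1)]
    have f0 : D0 = 1 - a * b * (q ^ (n + 1)) ^ 2 := by rw [e0]; ring
    have f1 : D1 = 1 - a * b * (q ^ (n + 1)) ^ 2 * q := by rw [e1]; ring
    have f2 : D2 = 1 - a * b * (q ^ (n + 1)) ^ 2 * q ^ 2 := by rw [e2]; ring
    clear e0 e1 e2 e0' e1' e2'
    generalize q ^ (n + 1) = z at *
    field_simp
    rw [f0, f1, f2]
    ring
  · have n1 := h (2 * n + 1)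
    have n2 := h (2 * n + 2)
    have n3 := h (2 * n + 3)
    have n4 := h (2 * n + 4)
    obtain ⟨D1, e1⟩ : ∃ D, D = 1 - a * b * q ^ (2 * n + 1 + 2) := ⟨_, rfl⟩
    obtain ⟨D2, e2⟩ : ∃ D, D = 1 - a * b * q ^ (2 * n + 2 + 2) := ⟨_, rfl⟩
    obtain ⟨D3, e3⟩ : ∃ D, D = 1 - a * b * q ^ (2 * n + 3 + 2) := ⟨_, rfl⟩
    obtain ⟨D4, e4⟩ : ∃ D, D = 1 - a * b * q ^ (2 * n + 4 + 2) := ⟨_, rfl⟩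
    rw [← e1] at n1
    rw [← e2] at n2
    rw [← e3] at n3
    rw [← e4] at n4
    rw [littleQJacobiPair_sub₁ hq0 h1 (D := D2) (by rw [e2]; ring) n2,
      littleQJacobiPair_sub₁ hq0 h1 (D := D4) (by rw [e4]; ring) n4,
      littleQJacobiPair_sub₂ hq0 h1 h2 (D := D2) (D' := D1) (by rw [e2]; ring) n2
        (by rw [e1]; ring) n1,
      littleQJacobiPair_sub₂ hq0 h1 h2 (D := D4) (D' := D3) (by rw [e4]; ring) n4
        (by rw [e3]; ring) n3]
    have e1' : 1 - a * b * q ^ (2 * (n + 1) + 1) = D1 := e1.symm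
    have e2' : 1 - a * b * q ^ (2 * (n + 1) + 2) = D2 := e2.symm
    have e2'' : 1 - a * b * q ^ (2 * (n + 1 + 1)) = D2 := e2.symm
    have e3' : 1 - a * b * q ^ (2 * (n + 1 + 1) + 1) = D3 := e3.symm
    simp only [littleQJacobiA, littleQJacobiC, jacobiFactor, Nat.succ_ne_zero, if_false, e1',
      e2', e2'', e3', pow_succ q (n + 1)]
    have f1 : D1 = 1 - a * b * (q ^ (n + 1)) ^ 2 * q := by rw [e1]; ring
    have f2 : D2 = 1 - a * b * (q ^ (n + 1)) ^ 2 * q ^ 2 := by rw [e2]; ring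
    have f3 : D3 = 1 - a * b * (q ^ (n + 1)) ^ 2 * q ^ 3 := by rw [e3]; ring
    have f4 : D4 = 1 - a * b * (q ^ (n + 1)) ^ 2 * q ^ 4 := by rw [e4]; ring
    clear e1 e2 e3 e4 e1' e2' e2'' e3'
    generalize q ^ (n + 1) = z at *
    field_simp
    rw [f1, f2, f3, f4]
    ring

/-- The data of the Al-Salam–Carlitz polynomials. -/
def alSalamCarlitzPair (a : ℂ) : QPair := ⟨a, 0, 0, -(1 + a), 1⟩

theorem alSalamCarlitz_eq {q : ℂ} (hq0 : q ≠ 0) (hq : ∀ n : ℕ, 1 ≤ n → q ^ n ≠ 1) (a : ℂ) :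
    alSalamCarlitz q a
      = ttrrSeq ((alSalamCarlitzPair a).beta q) ((alSalamCarlitzPair a).gamma q) := by
  have h1 : q - 1 ≠ 0 := sub_ne_zero.mpr (by simpa using hq 1 le_rfl)
  have h2 : q + 1 ≠ 0 := fun e => hq 2 (by omega) (by linear_combination (q - 1) * e)
  have e1 : ∀ z, (alSalamCarlitzPair a).sub₁ q z = -((z - 1) * (1 + a)) / (q - 1) := by
    intro z
    simp only [QPair.sub₁, alSalamCarlitzPair]
    rw [show (0 : ℂ) * z ^ 2 - 1 * q ^ 2 = -q ^ 2 by ring]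
    field_simp
    ring
  have e2 : ∀ z, (alSalamCarlitzPair a).sub₂ q z
      = (z - q) * (z - 1) * ((1 + a) ^ 2 * q - a * (q - 1)) / (q * (q + 1) * (q - 1) ^ 2) := by
    intro z
    rw [QPair.sub₂, e1]
    simp only [alSalamCarlitzPair]
    rw [show (0 : ℂ) * z ^ 2 - 1 * q ^ 3 = -q ^ 3 by ring,
      show q ^ 2 - 1 = (q + 1) * (q - 1) by ring]
    field_simp
    ring
  refine QPair.ttrrSeq_eq ?_ ?_ (fun n => ?_) (fun n => ?_)
  all_goals
    simp only [e1, e2, pow_succ q]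
    field_simp
    ring

/-- The data of the polynomials `l_n(x;a|q)`. -/
def smallLPair (q a : ℂ) : QPair := ⟨0, a * q, 0, 0, 1⟩

theorem smallL_eq {q : ℂ} (hq0 : q ≠ 0) (hq : ∀ n : ℕ, 1 ≤ n → q ^ n ≠ 1) (a : ℂ) :
    smallL q a = ttrrSeq ((smallLPair q a).beta q) ((smallLPair q a).gamma q) := by
  have h1 : q - 1 ≠ 0 := sub_ne_zero.mpr (by simpa using hq 1 le_rfl)
  have h2 : q + 1 ≠ 0 := fun e => hq 2 (by omega) (by linear_combination (q - 1) * e)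
  have e1 : ∀ z, (smallLPair q a).sub₁ q z = -(a * z * (z - 1)) / (q - 1) := by
    intro z
    simp only [QPair.sub₁, smallLPair]
    rw [show (0 : ℂ) * z ^ 2 - 1 * q ^ 2 = -q ^ 2 by ring]
    field_simp
    ring
  have e2 : ∀ z, (smallLPair q a).sub₂ q z
      = a ^ 2 * z ^ 2 * (z - q) * (z - 1) / (q * (q + 1) * (q - 1) ^ 2) := by
    intro z
    rw [QPair.sub₂, e1]
    simp only [smallLPair]
    rw [show (0 : ℂ) * z ^ 2 - 1 * q ^ 3 = -q ^ 3 by ring,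
      show q ^ 2 - 1 = (q + 1) * (q - 1) by ring]
    field_simp
    ring
  refine QPair.ttrrSeq_eq ?_ ?_ (fun n => ?_) (fun n => ?_)
  all_goals
    simp only [e1, e2, pow_succ q, pow_mul', pow_zero, mul_zero]
    field_simp
    ring

/-- The data of the `q`-Bessel polynomials. -/
def qBesselPair (q a : ℂ) : QPair := ⟨0, 0, a, q⁻¹, -q⁻¹⟩

theorem qBesselPair_sub₁ {q : ℂ} (hq0 : q ≠ 0) (h1 : q - 1 ≠ 0) {a z D : ℂ}
    (hD : q * D = q + a * z ^ 2) (h : D ≠ 0) : (qBesselPair q a).sub₁ q z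
      = -(z - 1) / ((q - 1) * D) := by
  have e : a * z ^ 2 - -q⁻¹ * q ^ 2 = q * D := by
    rw [hD]
    field_simp
    ring
  simp only [QPair.sub₁, qBesselPair]
  rw [e]
  field_simp
  ring

theorem qBesselPair_sub₂ {q : ℂ} (hq0 : q ≠ 0) (h1 : q - 1 ≠ 0) (h2 : q + 1 ≠ 0)
    {a z D D' : ℂ} (hD : q * D = q + a * z ^ 2) (h : D ≠ 0)
    (hD' : q ^ 2 * D' = q ^ 2 + a * z ^ 2) (h' : D' ≠ 0) :
    (qBesselPair q a).sub₂ q z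
      = (z - q) * (z - 1) / ((q + 1) * (q - 1) ^ 2 * D * D') := by
  have e : a * z ^ 2 - -q⁻¹ * q ^ 3 = q ^ 2 * D' := by
    rw [hD']
    field_simp
    ring
  have e2 : q ^ 2 - 1 = (q + 1) * (q - 1) := by ring
  rw [QPair.sub₂, qBesselPair_sub₁ hq0 h1 hD h]
  simp only [qBesselPair]
  rw [e, e2]
  field_simp
  ring

theorem qBessel_eq {q : ℂ} (hq0 : q ≠ 0) (hq : ∀ n : ℕ, 1 ≤ n → q ^ n ≠ 1) {a : ℂ}
    (h : ∀ k, 1 + a * q ^ (k + 1) ≠ 0) :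
    qBessel q a = ttrrSeq ((qBesselPair q a).beta q) ((qBesselPair q a).gamma q) := by
  have h1 : q - 1 ≠ 0 := sub_ne_zero.mpr (by simpa using hq 1 le_rfl)
  have h2 : q + 1 ≠ 0 := fun e => hq 2 (by omega) (by linear_combination (q - 1) * e)
  refine QPair.ttrrSeq_eq ?_ ?_ (fun n => ?_) (fun n => ?_)
  · have n1 := h 0
    rw [zero_add, pow_one] at n1
    obtain ⟨D1, e1⟩ : ∃ D, D = 1 + a * q := ⟨_, rfl⟩
    rw [← e1] at n1
    rw [qBesselPair_sub₁ hq0 h1 (D := D1) (by rw [e1]; ring) n1]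
    simp only [qBesselA, qBesselC, if_true, ← e1]
    field_simp
    ring
  · have n1 := h 0
    have n2 := h 1
    have n3 := h 2
    rw [zero_add, pow_one] at n1
    obtain ⟨D1, e1⟩ : ∃ D, D = 1 + a * q := ⟨_, rfl⟩
    obtain ⟨D2, e2⟩ : ∃ D, D = 1 + a * q ^ (1 + 1) := ⟨_, rfl⟩
    obtain ⟨D3, e3⟩ : ∃ D, D = 1 + a * q ^ (2 + 1) := ⟨_, rfl⟩
    rw [← e1] at n1
    rw [← e2] at n2
    rw [← e3] at n3
    rw [qBesselPair_sub₁ hq0 h1 (D := D1) (by rw [e1]; ring) n1,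
      qBesselPair_sub₁ hq0 h1 (D := D3) (by rw [e3]; ring) n3,
      qBesselPair_sub₂ hq0 h1 h2 (D := D3) (D' := D2) (by rw [e3]; ring) n3
        (by rw [e2]; ring) n2]
    have e1' : 1 + a * q ^ (2 * (0 + 1) - 1) = D1 := by rw [e1]; simp
    have e2' : 1 + a * q ^ (2 * (0 + 1)) = D2 := e2.symm
    simp only [qBesselA, qBesselC, if_true, Nat.succ_ne_zero, if_false, e1', e2', ← e1]
    rw [show 2 * (0 + 1) - 1 = 1 from rfl]
    field_simp
    rw [e1, e2, e3]
    ring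
  · have n1 := h (2 * n)
    have n2 := h (2 * n + 1)
    have n3 := h (2 * n + 2)
    obtain ⟨D1, e1⟩ : ∃ D, D = 1 + a * q ^ (2 * n + 1) := ⟨_, rfl⟩
    obtain ⟨D2, e2⟩ : ∃ D, D = 1 + a * q ^ (2 * n + 1 + 1) := ⟨_, rfl⟩
    obtain ⟨D3, e3⟩ : ∃ D, D = 1 + a * q ^ (2 * n + 2 + 1) := ⟨_, rfl⟩
    rw [← e1] at n1
    rw [← e2] at n2
    rw [← e3] at n3
    rw [qBesselPair_sub₁ hq0 h1 (D := D1) (by rw [e1]; ring) n1,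
      qBesselPair_sub₁ hq0 h1 (D := D3) (by rw [e3]; ring) n3]
    -- The truncated difference 2(n+1) - 1 is 2n+1 by computation, so no boundary case is lost.
    have e1' : 1 + a * q ^ (2 * (n + 1) - 1) = D1 := e1.symm
    have e2' : 1 + a * q ^ (2 * (n + 1)) = D2 := e2.symm
    have e3' : 1 + a * q ^ (2 * (n + 1) + 1) = D3 := e3.symm
    have e4 : q ^ (2 * (n + 1) - 1) = (q ^ n) ^ 2 * q := by
      rw [show 2 * (n + 1) - 1 = 2 * n + 1 from rfl]; ring
    simp only [qBesselA, qBesselC, Nat.succ_ne_zero, if_false, e1', e2', e3']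
    simp only [e4, pow_succ q n]
    have f1 : D1 = 1 + a * (q ^ n) ^ 2 * q := by rw [e1]; ring
    have f2 : D2 = 1 + a * (q ^ n) ^ 2 * q ^ 2 := by rw [e2]; ring
    have f3 : D3 = 1 + a * (q ^ n) ^ 2 * q ^ 3 := by rw [e3]; ring
    clear e1 e2 e3 e1' e2' e3' e4
    generalize q ^ n = z at *
    field_simp
    rw [f1, f2, f3]
    ring
  · have n2 := h (2 * n + 1)
    have n3 := h (2 * n + 2)
    have n4 := h (2 * n + 3)
    have n5 := h (2 * n + 4)
    obtain ⟨D2, e2⟩ : ∃ D, D = 1 + a * q ^ (2 * n + 1 + 1) := ⟨_, rfl⟩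
    obtain ⟨D3, e3⟩ : ∃ D, D = 1 + a * q ^ (2 * n + 2 + 1) := ⟨_, rfl⟩
    obtain ⟨D4, e4⟩ : ∃ D, D = 1 + a * q ^ (2 * n + 3 + 1) := ⟨_, rfl⟩
    obtain ⟨D5, e5⟩ : ∃ D, D = 1 + a * q ^ (2 * n + 4 + 1) := ⟨_, rfl⟩
    rw [← e2] at n2
    rw [← e3] at n3
    rw [← e4] at n4
    rw [← e5] at n5
    rw [qBesselPair_sub₁ hq0 h1 (D := D3) (by rw [e3]; ring) n3,
      qBesselPair_sub₁ hq0 h1 (D := D5) (by rw [e5]; ring) n5,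
      qBesselPair_sub₂ hq0 h1 h2 (D := D3) (D' := D2) (by rw [e3]; ring) n3
        (by rw [e2]; ring) n2,
      qBesselPair_sub₂ hq0 h1 h2 (D := D5) (D' := D4) (by rw [e5]; ring) n5
        (by rw [e4]; ring) n4]
    have e2' : 1 + a * q ^ (2 * (n + 1)) = D2 := e2.symm
    have e3' : 1 + a * q ^ (2 * (n + 1) + 1) = D3 := e3.symm
    have e3'' : 1 + a * q ^ (2 * (n + 1 + 1) - 1) = D3 := e3.symm
    have e4' : 1 + a * q ^ (2 * (n + 1 + 1)) = D4 := e4.symm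
    have e6 : q ^ (2 * (n + 1 + 1) - 1) = (q ^ n) ^ 2 * q ^ 3 := by
      rw [show 2 * (n + 1 + 1) - 1 = 2 * n + 3 from rfl]; ring
    simp only [qBesselA, qBesselC, Nat.succ_ne_zero, if_false, e2', e3', e3'', e4']
    simp only [e6, pow_succ q n, pow_succ q (n + 1)]
    have f2 : D2 = 1 + a * (q ^ n) ^ 2 * q ^ 2 := by rw [e2]; ring
    have f3 : D3 = 1 + a * (q ^ n) ^ 2 * q ^ 3 := by rw [e3]; ring
    have f4 : D4 = 1 + a * (q ^ n) ^ 2 * q ^ 4 := by rw [e4]; ring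
    have f5 : D5 = 1 + a * (q ^ n) ^ 2 * q ^ 5 := by rw [e5]; ring
    clear e2 e3 e4 e5 e2' e3' e3'' e4' e6
    generalize q ^ n = z at *
    field_simp
    rw [f2, f3, f4, f5]
    ring

/-- The data of the polynomials `j_n(x;a,b|q)`. -/
def smallJPair (q a b : ℂ) : QPair := ⟨0, -a * b * q, a * q, 0, 1⟩

/-- The pair is aqx(x - b) and x²; swapped, it has the shape of a q-Bessel pair. -/
theorem smallJPair_sub₁ {q : ℂ} (hq0 : q ≠ 0) (h1 : q - 1 ≠ 0) {a b z D : ℂ}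
    (hD : q * D = q - a * z ^ 2) (h : D ≠ 0) : (smallJPair q a b).sub₁ q z
      = a * b * z * (z - 1) / ((q - 1) * D) := by
  have e : a * q * z ^ 2 - 1 * q ^ 2 = -q * (q * D) := by
    rw [hD]
    ring
  simp only [QPair.sub₁, smallJPair]
  rw [e]
  field_simp
  ring

theorem smallJPair_sub₂ {q : ℂ} (hq0 : q ≠ 0) (h1 : q - 1 ≠ 0) (h2 : q + 1 ≠ 0)
    {a b z D D' : ℂ} (hD : q * D = q - a * z ^ 2) (h : D ≠ 0)
    (hD' : q ^ 2 * D' = q ^ 2 - a * z ^ 2) (h' : D' ≠ 0) :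
    (smallJPair q a b).sub₂ q z
      = a ^ 2 * b ^ 2 * z ^ 2 * (z - q) * (z - 1) / (q * (q + 1) * (q - 1) ^ 2 * D * D') := by
  have e : a * q * z ^ 2 - 1 * q ^ 3 = -q * (q ^ 2 * D') := by
    rw [hD']
    ring
  have e2 : q ^ 2 - 1 = (q + 1) * (q - 1) := by ring
  rw [QPair.sub₂, smallJPair_sub₁ hq0 h1 hD h]
  simp only [smallJPair]
  rw [e, e2]
  field_simp
  ring

theorem smallJ_eq {q : ℂ} (hq0 : q ≠ 0) (hq : ∀ n : ℕ, 1 ≤ n → q ^ n ≠ 1) {a b : ℂ}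
    (h : ∀ k, 1 - a * q ^ (k + 1) ≠ 0) :
    smallJ q a b = ttrrSeq ((smallJPair q a b).beta q) ((smallJPair q a b).gamma q) := by
  have h1 : q - 1 ≠ 0 := sub_ne_zero.mpr (by simpa using hq 1 le_rfl)
  have h2 : q + 1 ≠ 0 := fun e => hq 2 (by omega) (by linear_combination (q - 1) * e)
  refine QPair.ttrrSeq_eq ?_ ?_ (fun n => ?_) (fun n => ?_)
  · have n1 := h 0
    rw [zero_add, pow_one] at n1
    obtain ⟨D1, e1⟩ : ∃ D, D = 1 - a * q := ⟨_, rfl⟩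
    rw [← e1] at n1
    rw [smallJPair_sub₁ hq0 h1 (D := D1) (by rw [e1]; ring) n1]
    simp only [if_true, ← e1]
    field_simp
  · have n1 := h 0
    have n2 := h 1
    have n3 := h 2
    rw [zero_add, pow_one] at n1
    obtain ⟨D1, e1⟩ : ∃ D, D = 1 - a * q := ⟨_, rfl⟩
    obtain ⟨D2, e2⟩ : ∃ D, D = 1 - a * q ^ (1 + 1) := ⟨_, rfl⟩
    obtain ⟨D3, e3⟩ : ∃ D, D = 1 - a * q ^ (2 + 1) := ⟨_, rfl⟩
    rw [← e1] at n1
    rw [← e2] at n2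
    rw [← e3] at n3
    rw [smallJPair_sub₁ hq0 h1 (D := D1) (by rw [e1]; ring) n1,
      smallJPair_sub₁ hq0 h1 (D := D3) (by rw [e3]; ring) n3,
      smallJPair_sub₂ hq0 h1 h2 (D := D3) (D' := D2) (by rw [e3]; ring) n3
        (by rw [e2]; ring) n2]
    have e2' : 1 - a * q ^ 2 = D2 := e2.symm
    simp only [if_true, e2', ← e1]
    field_simp
    rw [e1, e2, e3]
    ring
  · have n1 := h (2 * n)
    have n3 := h (2 * n + 2)
    obtain ⟨D1, e1⟩ : ∃ D, D = 1 - a * q ^ (2 * n + 1) := ⟨_, rfl⟩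
    obtain ⟨D3, e3⟩ : ∃ D, D = 1 - a * q ^ (2 * n + 2 + 1) := ⟨_, rfl⟩
    rw [← e1] at n1
    rw [← e3] at n3
    rw [smallJPair_sub₁ hq0 h1 (D := D1) (by rw [e1]; ring) n1,
      smallJPair_sub₁ hq0 h1 (D := D3) (by rw [e3]; ring) n3]
    have e1' : 1 - a * q ^ (2 * (n + 1) - 1) = D1 := e1.symm
    have e3' : 1 - a * q ^ (2 * (n + 1) + 1) = D3 := e3.symm
    have e4 : q ^ (2 * (n + 1)) = (q ^ n * q) ^ 2 := by ring
    simp only [Nat.succ_ne_zero, if_false, e1', e3', e4, pow_succ q n]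
    have f1 : D1 = 1 - a * (q ^ n) ^ 2 * q := by rw [e1]; ring
    have f3 : D3 = 1 - a * (q ^ n) ^ 2 * q ^ 3 := by rw [e3]; ring
    clear e1 e3 e1' e3' e4
    generalize q ^ n = z at *
    field_simp
    rw [f1, f3]
    ring
  · have n2 := h (2 * n + 1)
    have n3 := h (2 * n + 2)
    have n4 := h (2 * n + 3)
    have n5 := h (2 * n + 4)
    obtain ⟨D2, e2⟩ : ∃ D, D = 1 - a * q ^ (2 * n + 1 + 1) := ⟨_, rfl⟩
    obtain ⟨D3, e3⟩ : ∃ D, D = 1 - a * q ^ (2 * n + 2 + 1) := ⟨_, rfl⟩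
    obtain ⟨D4, e4⟩ : ∃ D, D = 1 - a * q ^ (2 * n + 3 + 1) := ⟨_, rfl⟩
    obtain ⟨D5, e5⟩ : ∃ D, D = 1 - a * q ^ (2 * n + 4 + 1) := ⟨_, rfl⟩
    rw [← e2] at n2
    rw [← e3] at n3
    rw [← e4] at n4
    rw [← e5] at n5
    rw [smallJPair_sub₁ hq0 h1 (D := D3) (by rw [e3]; ring) n3,
      smallJPair_sub₁ hq0 h1 (D := D5) (by rw [e5]; ring) n5,
      smallJPair_sub₂ hq0 h1 h2 (D := D3) (D' := D2) (by rw [e3]; ring) n3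
        (by rw [e2]; ring) n2,
      smallJPair_sub₂ hq0 h1 h2 (D := D5) (D' := D4) (by rw [e5]; ring) n5
        (by rw [e4]; ring) n4]
    have e2' : 1 - a * q ^ (2 * (n + 1)) = D2 := e2.symm
    have e3' : 1 - a * q ^ (2 * (n + 1) + 1) = D3 := e3.symm
    have e4' : 1 - a * q ^ (2 * (n + 1) + 2) = D4 := e4.symm
    have e6 : q ^ (3 * (n + 1) + 2) = (q ^ n) ^ 3 * q ^ 5 := by ring
    simp only [Nat.succ_ne_zero, if_false, e2', e3', e4', e6, pow_succ q n, pow_succ q (n + 1)]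
    have f2 : D2 = 1 - a * (q ^ n) ^ 2 * q ^ 2 := by rw [e2]; ring
    have f3 : D3 = 1 - a * (q ^ n) ^ 2 * q ^ 3 := by rw [e3]; ring
    have f4 : D4 = 1 - a * (q ^ n) ^ 2 * q ^ 4 := by rw [e4]; ring
    have f5 : D5 = 1 - a * (q ^ n) ^ 2 * q ^ 5 := by rw [e5]; ring
    clear e2 e3 e4 e5 e2' e3' e4' e6
    generalize q ^ n = z at *
    field_simp
    rw [f2, f3, f4, f5]
    ring

theorem bigQLaguerre_eq_bigQJacobi (q a b : ℂ) : bigQLaguerre q a b = bigQJacobi q a 0 b := by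
  have hA : ∀ n, bigQJacobiA q a 0 b n = bigQLaguerreA q a b n := fun n => by
    simp [bigQJacobiA, bigQLaguerreA, jacobiFactor]
  have hC : ∀ n, bigQJacobiC q a 0 b n = bigQLaguerreC q a b n := fun n => by
    rcases n with _ | n <;> simp [bigQJacobiC, bigQLaguerreC]
  simp only [bigQLaguerre, bigQJacobi, hA, hC]

theorem littleQLaguerre_eq_littleQJacobi (q a : ℂ) :
    littleQLaguerre q a = littleQJacobi q a 0 := by
  have hA : ∀ n, littleQJacobiA q a 0 n = littleQLaguerreA q a n := fun n => by
    simp [littleQJacobiA, littleQLaguerreA, jacobiFactor]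
  have hC : ∀ n, littleQJacobiC q a 0 n = littleQLaguerreC q a n := fun n => by
    rcases n with _ | n <;> simp [littleQJacobiC, littleQLaguerreC]
  simp only [littleQLaguerre, littleQJacobi, hA, hC]

theorem not_mem_LambdaSet_iff {q : ℂ} (hq0 : q ≠ 0) (a : ℂ) :
    a ∉ LambdaSet q ↔ ∀ k : ℕ, 1 - a * q ^ (k + 1) ≠ 0 := by
  constructor
  · intro h k e
    refine h ⟨k + 1, by omega, eq_inv_of_mul_eq_one_left ?_⟩
    linear_combination -e
  · rintro h ⟨n, hn, rfl⟩
    apply h (n - 1)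
    rw [Nat.sub_add_cancel hn, inv_mul_cancel₀ (pow_ne_zero n hq0), sub_self]

theorem QPair.polyA_ne_zero {d : QPair} (h : ¬(d.a0 = 0 ∧ d.a1 = 0 ∧ d.a2 = 0)) :
    d.polyA ≠ 0 := by
  intro h0
  apply h
  have h1 : ∀ k, d.polyA.coeff k = 0 := fun k => by rw [h0, coeff_zero]
  refine ⟨?_, ?_, ?_⟩
  · simpa [QPair.polyA] using h1 0
  · simpa [QPair.polyA, coeff_X, coeff_C] using h1 1
  · simpa [QPair.polyA, coeff_X, coeff_C] using h1 2

theorem bigQJacobiPair_admissible_iff {q : ℂ} (hq0 : q ≠ 0) (a b c : ℂ) :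
    (bigQJacobiPair q a b c).Admissible q ↔ ∀ k : ℕ, 1 - a * b * q ^ (k + 2) ≠ 0 := by
  refine forall_congr' fun k => not_congr ?_
  simp only [bigQJacobiPair]
  constructor
  · intro h
    have h1 : a * b * q * q ^ k * q = 1 := by rw [h, inv_mul_cancel₀ hq0]
    linear_combination -h1
  · intro h
    apply mul_right_cancel₀ hq0
    rw [inv_mul_cancel₀ hq0]
    linear_combination -h

theorem littleQJacobiPair_admissible_iff {q : ℂ} (hq0 : q ≠ 0) (a b : ℂ) :
    (littleQJacobiPair q a b).Admissible q ↔ ∀ k : ℕ, 1 - a * b * q ^ (k + 2) ≠ 0 :=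
  -- Admissibility involves only the quadratic coefficients, which the two Jacobi pairs share.
  bigQJacobiPair_admissible_iff hq0 a b 0

theorem qBesselPair_admissible_iff {q : ℂ} (hq0 : q ≠ 0) (a : ℂ) :
    (qBesselPair q a).Admissible q ↔ ∀ k : ℕ, 1 + a * q ^ (k + 1) ≠ 0 := by
  refine forall_congr' fun k => not_congr ?_
  simp only [qBesselPair]
  constructor
  · intro h
    rw [pow_succ, ← mul_assoc, h, neg_mul, inv_mul_cancel₀ hq0]
    ring
  · intro h
    apply mul_right_cancel₀ hq0
    rw [neg_mul, inv_mul_cancel₀ hq0]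
    linear_combination h

theorem smallJPair_admissible {q : ℂ} {a b : ℂ}
    (h : ∀ k : ℕ, 1 - a * q ^ (k + 1) ≠ 0) : (smallJPair q a b).Admissible q := by
  intro k e
  simp only [smallJPair] at e
  exact h k (by linear_combination -e)

theorem mul_mul_pow_ne {q a b : ℂ} (h : ∀ k : ℕ, 1 - a * b * q * q ^ (k + 1) ≠ 0) (k : ℕ) :
    1 - a * b * q ^ (k + 2) ≠ 0 := fun e => h k (by linear_combination e)

/-- Every sequence of the table consists of eigenpolynomials of an admissible `qHyp`. -/
theorem exists_pair_of_isQClassical {q : ℂ} (hq0 : q ≠ 0) (hq : ∀ n : ℕ, 1 ≤ n → q ^ n ≠ 1)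
    {R : ℕ → ℂ[X]} (h : IsQClassical q R) :
    ∃ d : QPair, ¬(d.a0 = 0 ∧ d.a1 = 0 ∧ d.a2 = 0) ∧ ¬(d.a0 = 0 ∧ d.b1 = 0 ∧ d.b2 = 0) ∧
      d.Admissible q ∧ R = ttrrSeq (d.beta q) (d.gamma q) := by
  -- Nonvanishing of a is what base p = q requires; nonvanishing of b serves p = 1/q, where the pair
  -- is swapped.
  have hqi := inv_ne_zero hq0
  have jac : ∀ a b c : ℂ, a * c ≠ 0 → (∀ k : ℕ, 1 - a * b * q ^ (k + 2) ≠ 0) →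
      ∃ d : QPair, ¬(d.a0 = 0 ∧ d.a1 = 0 ∧ d.a2 = 0) ∧ ¬(d.a0 = 0 ∧ d.b1 = 0 ∧ d.b2 = 0) ∧
      d.Admissible q ∧ bigQJacobi q a b c = ttrrSeq (d.beta q) (d.gamma q) := fun a b c hac hab =>
    ⟨bigQJacobiPair q a b c, fun h => mul_ne_zero hac hq0 h.1, fun h => mul_ne_zero hac hq0 h.1,
      (bigQJacobiPair_admissible_iff hq0 a b c).mpr hab,
      bigQJacobi_eq hq0 hq (right_ne_zero_of_mul hac) hab⟩
  have ljac : ∀ a b : ℂ, a ≠ 0 → (∀ k : ℕ, 1 - a * b * q ^ (k + 2) ≠ 0) →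
      ∃ d : QPair, ¬(d.a0 = 0 ∧ d.a1 = 0 ∧ d.a2 = 0) ∧ ¬(d.a0 = 0 ∧ d.b1 = 0 ∧ d.b2 = 0) ∧
      d.Admissible q ∧ littleQJacobi q a b = ttrrSeq (d.beta q) (d.gamma q) := fun a b ha hab =>
    ⟨littleQJacobiPair q a b, fun h => neg_ne_zero.mpr ha h.2.1, fun h => hqi h.2.2,
      (littleQJacobiPair_admissible_iff hq0 a b).mpr hab, littleQJacobi_eq hq0 hq hab⟩
  cases h with
  | alSalamCarlitz a ha =>
    exact ⟨alSalamCarlitzPair a, fun h => ha h.1, fun h => ha h.1,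
      fun k => by simp [alSalamCarlitzPair], alSalamCarlitz_eq hq0 hq a⟩
  | bigQLaguerre a b hab ha hb =>
    rw [bigQLaguerre_eq_bigQJacobi]
    exact jac a 0 b hab (by simp)
  | littleQLaguerre a ha ha' =>
    rw [littleQLaguerre_eq_littleQJacobi]
    exact ljac a 0 ha (by simp)
  | smallL a ha =>
    exact ⟨smallLPair q a, fun h => mul_ne_zero ha hq0 h.2.1, fun h => one_ne_zero h.2.2,
      fun k => by simp [smallLPair], smallL_eq hq0 hq a⟩
  | bigQJacobi a b c hac ha hb hc habq habc =>
    rw [not_mem_LambdaSet_iff hq0] at habq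
    exact jac a b c hac (mul_mul_pow_ne habq)
  | littleQJacobi a b ha ha' hb habq =>
    rw [not_mem_LambdaSet_iff hq0] at habq
    exact ljac a b ha (mul_mul_pow_ne habq)
  | qBessel a ha ha' =>
    rw [not_mem_LambdaSet_iff hq0] at ha'
    have h : ∀ k : ℕ, 1 + a * q ^ (k + 1) ≠ 0 := fun k e => ha' k (by linear_combination e)
    exact ⟨qBesselPair q a, fun h => ha h.2.2, fun h => hqi h.2.1,
      (qBesselPair_admissible_iff hq0 a).mpr h, qBessel_eq hq0 hq h⟩
  | smallJ a b hab ha =>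
    rw [not_mem_LambdaSet_iff hq0] at ha
    exact ⟨smallJPair q a b, fun h => mul_ne_zero (left_ne_zero_of_mul hab) hq0 h.2.2,
      fun h => one_ne_zero h.2.2, smallJPair_admissible ha, smallJ_eq hq0 hq ha⟩

/-! ### Classification of admissible pairs -/

theorem IsMonicOPS.of_affineSeq {r : ℂ} (hr : r ≠ 0) {R : ℕ → ℂ[X]}
    (hR : ∀ n, (R n).Monic ∧ (R n).natDegree = n) (h : IsMonicOPS (affineSeq r 0 R)) :
    IsMonicOPS R := by
  obtain ⟨-, u, hu⟩ := h
  refine ⟨hR, u ∘ₗ (Polynomial.aeval (C r⁻¹ * (X - C 0) : ℂ[X])).toLinearMap, fun n m => ?_⟩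
  have e : aeval (C r⁻¹ * (X - C 0) : ℂ[X]) (R n * R m)
      = C ((r ^ n)⁻¹ * (r ^ m)⁻¹) * (affineSeq r 0 R n * affineSeq r 0 R m) := by
    have e1 : ∀ n, C (r ^ n)⁻¹ * affineSeq r 0 R n = (R n).comp (C r⁻¹ * (X - C 0)) := fun n => by
      rw [affineSeq, ← mul_assoc, ← C_mul, inv_mul_cancel₀ (pow_ne_zero n hr), C_1, one_mul]
    rw [← comp_eq_aeval, mul_comp, ← e1, ← e1, C_mul]
    ring
  have hc : (r ^ n)⁻¹ * (r ^ m)⁻¹ ≠ 0 :=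
    mul_ne_zero (inv_ne_zero (pow_ne_zero n hr)) (inv_ne_zero (pow_ne_zero m hr))
  rw [LinearMap.comp_apply, AlgHom.toLinearMap_apply, e, map_C_mul]
  exact ⟨fun hnm => by rw [(hu n m).1 hnm, mul_zero], fun hnm => mul_ne_zero hc ((hu n m).2 hnm)⟩

/-- Change of variable for the eigenpolynomials of `qHyp`. -/
theorem ttrrSeq_scale {q : ℂ} (hq0 : q ≠ 0) (hq : ∀ n : ℕ, 1 ≤ n → q ^ n ≠ 1) {d : QPair}
    {t r : ℂ} (hr : r ≠ 0) (hd : (d.scale t r).Admissible q) :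
    affineSeq r 0 (ttrrSeq (d.beta q) (d.gamma q))
      = ttrrSeq ((d.scale t r).beta q) ((d.scale t r).gamma q) := by
  have hq1 : q ≠ 1 := by simpa using hq 1 le_rfl
  exact eigen_eq_ttrrSeq hq0 hq hd (affineSeq_monic hr (ttrrSeq_monic _ _))
    (qHyp_affineSeq hq0 hq1 hr (ttrrSeq_eigen hq0 hq hd.of_scale))

theorem exists_add_mul_eq (s p : ℂ) : ∃ x y : ℂ, x + y = s ∧ x * y = p := by
  obtain ⟨w, hw⟩ := IsAlgClosed.exists_pow_nat_eq (s ^ 2 - 4 * p) (n := 2) (by norm_num)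
  exact ⟨(s + w) / 2, (s - w) / 2, by ring, by linear_combination -hw / 4⟩

theorem eq_affineSeq_of_scale {q : ℂ} (hq0 : q ≠ 0) (hq : ∀ n : ℕ, 1 ≤ n → q ^ n ≠ 1)
    {d d₀ : QPair} (hd : d.Admissible q) {t r : ℂ} (hr : r ≠ 0) (h : d = d₀.scale t r) :
    d₀.Admissible q ∧ ttrrSeq (d.beta q) (d.gamma q)
      = affineSeq r 0 (ttrrSeq (d₀.beta q) (d₀.gamma q)) := by
  subst h
  exact ⟨hd.of_scale, (ttrrSeq_scale hq0 hq hr hd).symm⟩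

/-- Factor b = b2(x - ρ₁)(x - ρ₂) and a = a0(1 - σ₁x)(1 - σ₂x). Reciprocal roots allow deg a < 2,
and σ₁ ≠ 0 can be arranged because a is not constant. Rescaling moves the root 1/σ₁ of a to 1. -/
theorem classify_bigQJacobi {q : ℂ} (hq0 : q ≠ 0) (hq : ∀ n : ℕ, 1 ≤ n → q ^ n ≠ 1)
    {d : QPair} (hd : d.Admissible q) (hP : IsMonicOPS (ttrrSeq (d.beta q) (d.gamma q)))
    (h0 : d.a0 ≠ 0) (h2 : d.b2 ≠ 0) (h1 : ¬(d.a1 = 0 ∧ d.a2 = 0)) :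
    ∃ R : ℕ → ℂ[X], IsQClassical q R ∧
      ∃ r : ℂ, r ≠ 0 ∧ ttrrSeq (d.beta q) (d.gamma q) = affineSeq r 0 R := by
  obtain ⟨ρ₁, ρ₂, hρs, hρp⟩ := exists_add_mul_eq (-(d.b1 / d.b2)) (d.a0 / d.b2)
  obtain ⟨σ₁, σ₂, hσ, hσs, hσp⟩ : ∃ x y : ℂ, x ≠ 0 ∧ x + y = -(d.a1 / d.a0) ∧
      x * y = d.a2 / d.a0 := by
    obtain ⟨x, y, hs, hp⟩ := exists_add_mul_eq (-(d.a1 / d.a0)) (d.a2 / d.a0)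
    by_cases hx : x = 0
    · refine ⟨y, x, fun hy => h1 ?_, by rw [add_comm, hs], by rw [mul_comm, hp]⟩
      rw [hx, hy, add_zero, eq_comm, neg_eq_zero, div_eq_zero_iff] at hs
      rw [hx, hy, mul_zero, eq_comm, div_eq_zero_iff] at hp
      exact ⟨hs.resolve_right h0, hp.resolve_right h0⟩
    · exact ⟨x, y, hx, hs, hp⟩
  have e0 : d.a0 = d.b2 * (ρ₁ * ρ₂) := by rw [hρp]; field_simp
  have hρ : ρ₁ * ρ₂ ≠ 0 := by rw [hρp]; exact div_ne_zero h0 h2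
  have hρ₁ := left_ne_zero_of_mul hρ
  have hρ₂ := right_ne_zero_of_mul hρ
  have e1 : d.a1 = -(d.a0 * (σ₁ + σ₂)) := by rw [hσs]; field_simp
  have e2 : d.a2 = d.a0 * (σ₁ * σ₂) := by rw [hσp]; field_simp
  have e3 : d.b1 = -(d.b2 * (ρ₁ + ρ₂)) := by rw [hρs]; field_simp
  rw [e0] at e1 e2
  -- After rescaling, the roots ρ₁σ₁ and ρ₂σ₁ of b must be aq and cq, and σ₂/σ₁ must be b/c.
  obtain ⟨a, ha⟩ : ∃ a, a = ρ₁ * σ₁ / q := ⟨_, rfl⟩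
  obtain ⟨b, hb⟩ : ∃ b, b = ρ₂ * σ₂ / q := ⟨_, rfl⟩
  obtain ⟨c, hc⟩ : ∃ c, c = ρ₂ * σ₁ / q := ⟨_, rfl⟩
  have ha0 : a ≠ 0 := by rw [ha]; exact div_ne_zero (mul_ne_zero hρ₁ hσ) hq0
  have hc0 : c ≠ 0 := by rw [hc]; exact div_ne_zero (mul_ne_zero hρ₂ hσ) hq0
  have hr : σ₁⁻¹ ≠ 0 := inv_ne_zero hσ
  have hscale : d = (bigQJacobiPair q a b c).scale (q * d.b2) σ₁⁻¹ := by
    obtain ⟨a0, a1, a2, b1, b2⟩ := d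
    simp only at e0 e1 e2 e3 h2
    simp only [QPair.scale, bigQJacobiPair, QPair.mk.injEq]
    rw [e0, e1, e2, e3, ha, hb, hc]
    refine ⟨?_, ?_, ?_, ?_, ?_⟩ <;> field_simp
    ring
  obtain ⟨hadm, heq⟩ := eq_affineSeq_of_scale hq0 hq hd hr hscale
  rw [bigQJacobiPair_admissible_iff hq0] at hadm
  rw [← bigQJacobi_eq hq0 hq hc0 hadm] at heq
  rw [heq] at hP
  have hγ := (hP.of_affineSeq hr (ttrrSeq_monic _ _)).gamma_ne_zero
  -- A forbidden value of a or c would annihilate some A_n, one of b or ab/c some C_n; the condition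
  -- on abq is admissibility.
  have hA : ∀ n, bigQJacobiA q a b c n ≠ 0 := fun n => left_ne_zero_of_mul (hγ n)
  have hC : ∀ n, bigQJacobiC q a b c (n + 1) ≠ 0 := fun n => right_ne_zero_of_mul (hγ n)
  refine ⟨_, IsQClassical.bigQJacobi a b c (mul_ne_zero ha0 hc0) ?_ ?_ ?_ ?_ ?_, _, hr, heq⟩ <;>
    rw [not_mem_LambdaSet_iff hq0] <;> intro k e
  · exact hA k (by simp [bigQJacobiA, e])
  · exact hC k (by simp [bigQJacobiC, e])
  · exact hA k (by simp [bigQJacobiA, e])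
  · exact hadm k (by linear_combination e)
  · exact hC k (by simp [bigQJacobiC, e])

/-- Here a is constant, and b is normalised by moving one of its roots to 1; the parameter is the
ratio of the roots. -/
theorem classify_alSalamCarlitz {q : ℂ} (hq0 : q ≠ 0) (hq : ∀ n : ℕ, 1 ≤ n → q ^ n ≠ 1)
    {d : QPair} (hd : d.Admissible q)
    (h0 : d.a0 ≠ 0) (h2 : d.b2 ≠ 0) (ha1 : d.a1 = 0) (ha2 : d.a2 = 0) :
    ∃ R : ℕ → ℂ[X], IsQClassical q R ∧
      ∃ r : ℂ, r ≠ 0 ∧ ttrrSeq (d.beta q) (d.gamma q) = affineSeq r 0 R := by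
  obtain ⟨ρ₁, ρ₂, hρs, hρp⟩ := exists_add_mul_eq (-(d.b1 / d.b2)) (d.a0 / d.b2)
  have e0 : d.a0 = d.b2 * (ρ₁ * ρ₂) := by rw [hρp]; field_simp
  have hρ : ρ₁ * ρ₂ ≠ 0 := by rw [hρp]; exact div_ne_zero h0 h2
  have hρ₁ := left_ne_zero_of_mul hρ
  have hρ₂ := right_ne_zero_of_mul hρ
  have e3 : d.b1 = -(d.b2 * (ρ₁ + ρ₂)) := by rw [hρs]; field_simp
  have hscale : d = (alSalamCarlitzPair (ρ₂ / ρ₁)).scale d.b2 ρ₁ := by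
    obtain ⟨a0, a1, a2, b1, b2⟩ := d
    simp only at e0 e3 h2 ha1 ha2
    simp only [QPair.scale, alSalamCarlitzPair, QPair.mk.injEq]
    rw [e0, e3, ha1, ha2]
    refine ⟨?_, ?_, ?_, ?_, ?_⟩ <;> field_simp <;> ring
  obtain ⟨-, heq⟩ := eq_affineSeq_of_scale hq0 hq hd hρ₁ hscale
  rw [← alSalamCarlitz_eq hq0 hq] at heq
  exact ⟨_, IsQClassical.alSalamCarlitz _ (div_ne_zero hρ₂ hρ₁), _, hρ₁, heq⟩

/-- Both polynomials vanish at 0, and the other root -b1/b2 of b is moved to 1. The same scaling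
serves for q-Bessel. -/
theorem classify_littleQJacobi {q : ℂ} (hq0 : q ≠ 0) (hq : ∀ n : ℕ, 1 ≤ n → q ^ n ≠ 1)
    {d : QPair} (hd : d.Admissible q) (hP : IsMonicOPS (ttrrSeq (d.beta q) (d.gamma q)))
    (h0 : d.a0 = 0) (ha1 : d.a1 ≠ 0) (hb1 : d.b1 ≠ 0) (hb2 : d.b2 ≠ 0) :
    ∃ R : ℕ → ℂ[X], IsQClassical q R ∧
      ∃ r : ℂ, r ≠ 0 ∧ ttrrSeq (d.beta q) (d.gamma q) = affineSeq r 0 R := by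
  obtain ⟨a, ha⟩ : ∃ a, a = d.a1 / (q * d.b1) := ⟨_, rfl⟩
  obtain ⟨b, hb⟩ : ∃ b, b = d.a2 * d.b1 / (q * d.b2 * d.a1) := ⟨_, rfl⟩
  have ha0 : a ≠ 0 := by rw [ha]; exact div_ne_zero ha1 (mul_ne_zero hq0 hb1)
  have hr : -(d.b1 / d.b2) ≠ 0 := neg_ne_zero.mpr (div_ne_zero hb1 hb2)
  have hscale : d = (littleQJacobiPair q a b).scale (q * d.b2) (-(d.b1 / d.b2)) := by
    rw [ha, hb]
    obtain ⟨a0, a1, a2, b1, b2⟩ := d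
    simp only at h0 ha1 hb1 hb2
    simp only [QPair.scale, littleQJacobiPair, QPair.mk.injEq]
    rw [h0]
    refine ⟨?_, ?_, ?_, ?_, ?_⟩ <;> field_simp
    ring
  obtain ⟨hadm, heq⟩ := eq_affineSeq_of_scale hq0 hq hd hr hscale
  rw [littleQJacobiPair_admissible_iff hq0] at hadm
  rw [← littleQJacobi_eq hq0 hq hadm] at heq
  rw [heq] at hP
  have hγ := (hP.of_affineSeq hr (ttrrSeq_monic _ _)).gamma_ne_zero
  have hA : ∀ n, littleQJacobiA q a b n ≠ 0 := fun n => left_ne_zero_of_mul (hγ n)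
  have hC : ∀ n, littleQJacobiC q a b (n + 1) ≠ 0 := fun n => right_ne_zero_of_mul (hγ n)
  refine ⟨_, IsQClassical.littleQJacobi a b ha0 ?_ ?_ ?_, _, hr, heq⟩ <;>
    rw [not_mem_LambdaSet_iff hq0] <;> intro k e
  · exact hA k (by simp [littleQJacobiA, e])
  · exact hC k (by simp [littleQJacobiC, e])
  · exact hadm k (by linear_combination e)

theorem classify_qBessel {q : ℂ} (hq0 : q ≠ 0) (hq : ∀ n : ℕ, 1 ≤ n → q ^ n ≠ 1)
    {d : QPair} (hd : d.Admissible q)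
    (h0 : d.a0 = 0) (ha1 : d.a1 = 0) (ha2 : d.a2 ≠ 0) (hb1 : d.b1 ≠ 0) (hb2 : d.b2 ≠ 0) :
    ∃ R : ℕ → ℂ[X], IsQClassical q R ∧
      ∃ r : ℂ, r ≠ 0 ∧ ttrrSeq (d.beta q) (d.gamma q) = affineSeq r 0 R := by
  obtain ⟨a, ha⟩ : ∃ a, a = -(d.a2 / (q * d.b2)) := ⟨_, rfl⟩
  have ha0 : a ≠ 0 := by rw [ha]; exact neg_ne_zero.mpr (div_ne_zero ha2 (mul_ne_zero hq0 hb2))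
  have hr : -(d.b1 / d.b2) ≠ 0 := neg_ne_zero.mpr (div_ne_zero hb1 hb2)
  have hscale : d = (qBesselPair q a).scale (-(q * d.b2)) (-(d.b1 / d.b2)) := by
    rw [ha]
    obtain ⟨a0, a1, a2, b1, b2⟩ := d
    simp only at h0 ha1 ha2 hb1 hb2
    simp only [QPair.scale, qBesselPair, QPair.mk.injEq]
    rw [h0, ha1]
    refine ⟨?_, ?_, ?_, ?_, ?_⟩ <;> field_simp <;> ring
  obtain ⟨hadm, heq⟩ := eq_affineSeq_of_scale hq0 hq hd hr hscale
  rw [qBesselPair_admissible_iff hq0] at hadm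
  rw [← qBessel_eq hq0 hq hadm] at heq
  refine ⟨_, IsQClassical.qBessel a ha0 ?_, _, hr, heq⟩
  rw [not_mem_LambdaSet_iff hq0]
  exact fun k e => hadm k (by linear_combination e)

/-- The pair is a1 x, b2 x². The parameter of this row is itself a scale, so r = 1 suffices. -/
theorem classify_smallL {q : ℂ} (hq0 : q ≠ 0) (hq : ∀ n : ℕ, 1 ≤ n → q ^ n ≠ 1)
    {d : QPair} (hd : d.Admissible q)
    (h0 : d.a0 = 0) (ha1 : d.a1 ≠ 0) (ha2 : d.a2 = 0) (hb1 : d.b1 = 0) (hb2 : d.b2 ≠ 0) :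
    ∃ R : ℕ → ℂ[X], IsQClassical q R ∧
      ∃ r : ℂ, r ≠ 0 ∧ ttrrSeq (d.beta q) (d.gamma q) = affineSeq r 0 R := by
  have hscale : d = (smallLPair q (d.a1 / (d.b2 * q))).scale d.b2 1 := by
    obtain ⟨a0, a1, a2, b1, b2⟩ := d
    simp only at h0 ha1 ha2 hb1 hb2
    simp only [QPair.scale, smallLPair, QPair.mk.injEq]
    rw [h0, ha2, hb1]
    refine ⟨?_, ?_, ?_, ?_, ?_⟩ <;> field_simp <;> ring
  obtain ⟨-, heq⟩ := eq_affineSeq_of_scale hq0 hq hd one_ne_zero hscale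
  rw [← smallL_eq hq0 hq] at heq
  exact ⟨_, IsQClassical.smallL _ (div_ne_zero ha1 (mul_ne_zero hb2 hq0)), _, one_ne_zero, heq⟩

/-- The pairs which belong to a row of the table with the same base `q`. -/
def QPair.IsTabulated (d : QPair) : Prop :=
  d.b2 ≠ 0 ∧ (d.a0 ≠ 0 ∨ d.a0 = 0 ∧ d.b1 ≠ 0 ∧ (d.a1 ≠ 0 ∨ d.a1 = 0 ∧ d.a2 ≠ 0) ∨
    d.a0 = 0 ∧ d.a1 ≠ 0 ∧ d.a2 = 0 ∧ d.b1 = 0)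

theorem QPair.IsTabulated.exists_isQClassical {q : ℂ} (hq0 : q ≠ 0)
    (hq : ∀ n : ℕ, 1 ≤ n → q ^ n ≠ 1) {d : QPair} (hT : d.IsTabulated) (hd : d.Admissible q)
    (hP : IsMonicOPS (ttrrSeq (d.beta q) (d.gamma q))) :
    ∃ R : ℕ → ℂ[X], IsQClassical q R ∧
      ∃ r : ℂ, r ≠ 0 ∧ ttrrSeq (d.beta q) (d.gamma q) = affineSeq r 0 R := by
  obtain ⟨hb2, h0 | ⟨h0, hb1, ha1 | ⟨ha1, ha2⟩⟩ | ⟨h0, ha1, ha2, hb1⟩⟩ := hT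
  · by_cases h1 : d.a1 = 0 ∧ d.a2 = 0
    · exact classify_alSalamCarlitz hq0 hq hd h0 hb2 h1.1 h1.2
    · exact classify_bigQJacobi hq0 hq hd hP h0 hb2 h1
  · exact classify_littleQJacobi hq0 hq hd hP h0 ha1 hb1 hb2
  · exact classify_qBessel hq0 hq hd h0 ha1 ha2 hb1 hb2
  · exact classify_smallL hq0 hq hd h0 ha1 ha2 hb1 hb2

/-- The first recurrence coefficient `γ_1` vanishes in the degenerate cases. -/
theorem QPair.gamma_zero_eq_zero {q : ℂ} (hq0 : q ≠ 0) (hq : ∀ n : ℕ, 1 ≤ n → q ^ n ≠ 1)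
    {d : QPair} (hd : d.Admissible q) (h0 : d.a0 = 0)
    (h : d.a1 = 0 ∧ d.b1 = 0 ∨ d.a1 = 0 ∧ d.a2 = 0 ∨ d.b1 = 0 ∧ d.b2 = 0) :
    d.gamma q 0 = 0 := by
  have h1 : q - 1 ≠ 0 := sub_ne_zero.mpr (by simpa using hq 1 le_rfl)
  have h2 : q + 1 ≠ 0 := fun e => hq 2 (by omega) (by linear_combination (q - 1) * e)
  have h3 : q ^ 2 - 1 = (q - 1) * (q + 1) := by ring
  obtain ⟨a0, a1, a2, b1, b2⟩ := d
  have hne := hd 0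
  simp only [pow_zero, mul_one] at hne h0 h
  simp only [QPair.gamma, QPair.beta, QPair.sub₂, QPair.sub₁, h0, h3]
  -- The cases are: both polynomials are multiples of x², so the eigenpolynomials are the monomials;
  -- a = 0; b = 0.
  rcases h with ⟨rfl, rfl⟩ | ⟨rfl, rfl⟩ | ⟨rfl, rfl⟩
  · simp
  · have hb : b2 ≠ 0 := hne.symm
    simp only [zero_mul, zero_sub, zero_add, pow_one, sub_self, mul_zero, zero_div]
    field_simp
    ring
  · have ha : a2 ≠ 0 := hne
    simp only [zero_mul, sub_zero, zero_add, pow_one, sub_self, mul_zero, zero_div]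
    field_simp
    ring

/-- Admissibility excludes a2 = b2 = 0 and γ_1 ≠ 0 excludes the degenerate pairs. What is left is a
finite check on which coefficients vanish; for instance b = b2 x² with a1, a2 ≠ 0 and a0 = 0 becomes
a q-Bessel pair after swapping. -/
theorem QPair.isTabulated_or_swap {q : ℂ} (hq0 : q ≠ 0) (hq : ∀ n : ℕ, 1 ≤ n → q ^ n ≠ 1)
    {d : QPair} (hd : d.Admissible q) (hγ : d.gamma q 0 ≠ 0) :
    d.IsTabulated ∨ d.swap.IsTabulated := by
  have hdeg := fun h0 h => hγ (QPair.gamma_zero_eq_zero hq0 hq hd h0 h)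
  have hne : ¬(d.a2 = 0 ∧ d.b2 = 0) := fun h => hd 0 (by rw [h.1, h.2, zero_mul])
  unfold QPair.IsTabulated QPair.swap
  simp only
  tauto

/-! ### The equivalence -/

theorem mainTheorem1 (q ω : ℂ) (hq0 : q ≠ 0) (hq : ∀ n : ℕ, 1 ≤ n → q ^ n ≠ 1)
    (P : ℕ → ℂ[X]) (hP : IsMonicOPS P) :
    SelfCoherent q ω P ↔
      ∃ p : ℂ, (p = q ∨ p = q⁻¹) ∧ ∃ R : ℕ → ℂ[X], IsQClassical p R ∧
        ∃ r : ℂ, r ≠ 0 ∧ P = affineSeq r (ω / (1 - q)) R := by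
  have hq1 : q ≠ 1 := by simpa using hq 1 le_rfl
  have hqi0 := inv_ne_zero hq0
  have hqi := inv_pow_ne_one hq
  have hqi1 : q⁻¹ ≠ 1 := by simpa using hq1
  rw [selfCoherent_iff_comp hq1]
  have hP' := hP.comp_X_add_C (ω / (1 - q))
  have hiff := fun r R => eq_affineSeq_iff r (ω / (1 - q)) P R
  generalize (fun n => (P n).comp (X + C (ω / (1 - q)))) = Q at hP' hiff
  simp only [hiff]
  constructor
  · intro h
    obtain ⟨d, -, hd, he⟩ := exists_eigen_of_selfCoherent hq0 hq hP' h
    have hQ := eigen_eq_ttrrSeq hq0 hq hd hP'.1 he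
    -- The same sequence also belongs to the swapped pair with base 1/q, so whichever orientation is
    -- tabulated can be used.
    have hQ' := eigen_eq_ttrrSeq hqi0 hqi (hd.swap hq0) hP'.1
      (fun n => qHyp_swap hq0 hq1 (he n))
    have hγ : d.gamma q 0 ≠ 0 := by
      rw [hQ] at hP'
      exact hP'.gamma_ne_zero 0
    rcases QPair.isTabulated_or_swap hq0 hq hd hγ with hT | hT
    · refine ⟨q, Or.inl rfl, ?_⟩
      rw [hQ] at hP' ⊢
      exact hT.exists_isQClassical hq0 hq hd hP'
    · refine ⟨q⁻¹, Or.inr rfl, ?_⟩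
      rw [hQ'] at hP' ⊢
      exact hT.exists_isQClassical hqi0 hqi (hd.swap hq0) hP'
  · rintro ⟨p, hp, R, hR, r, hr, rfl⟩
    rcases hp with rfl | rfl
    · obtain ⟨d, hA, -, hd, rfl⟩ := exists_pair_of_isQClassical hq0 hq hR
      refine selfCoherent_of_eigen hq0 hq hP' (d := d.scale 1 r) (QPair.polyA_ne_zero fun h => hA ?_)
        (hd.scale one_ne_zero r) (qHyp_affineSeq hq0 hq1 hr (ttrrSeq_eigen hq0 hq hd))
      simpa [QPair.scale, hr] using h
    -- For a row with base 1/q, the rescaled pair is swapped to return to base q; its first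
    -- polynomial is then the former b.
    · obtain ⟨d, -, hB, hd, rfl⟩ := exists_pair_of_isQClassical hqi0 hqi hR
      have hd' : (d.scale 1 r).swap.Admissible q := by
        have := (hd.scale one_ne_zero r).swap hqi0
        rwa [inv_inv] at this
      have he : ∀ n, qHyp q (d.scale 1 r).swap (affineSeq r 0 (ttrrSeq (d.beta q⁻¹) (d.gamma q⁻¹)) n)
          = C ((d.scale 1 r).swap.eig q n)
            * affineSeq r 0 (ttrrSeq (d.beta q⁻¹) (d.gamma q⁻¹)) n := fun n => by
        have := qHyp_swap hqi0 hqi1 (qHyp_affineSeq (t := 1) hqi0 hqi1 hr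
          (ttrrSeq_eigen hqi0 hqi hd) n)
        rwa [inv_inv] at this
      refine selfCoherent_of_eigen hq0 hq hP' (d := (d.scale 1 r).swap)
        (QPair.polyA_ne_zero fun h => hB ?_) hd' he
      simpa [QPair.scale, QPair.swap, hr] using h

end
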